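/- For $k\ge 1$, a BDD of index $k$ consists of a finite set of nodes $Q$ containing two distinct sinks $\bot,\top$, an index function $I:Q\to\{0,\dots,k\}$ with $I(\bot)=I(\top)=0$, a root $r\in Q$ with $I(r)=k$, and a map $\delta:(Q\setminus\{\bot,\top\})\times\{0,1\}\to Q$ such that: $\delta(\nu,0)\ne\delta(\nu,1)$ for every non-sink $\nu$; distinct non-sink nodes $\mu,\nu$ with $I(\mu)=I(\nu)$ satisfy $\delta(\mu,0)\ne\delta(\nu,0)$ or $\delta(\mu,1)\neq\delta(\nu,1)$; $I(\delta(\nu,\alpha))<I(\nu)$ always; and $r$ is the unique node of in-degree $0$. Its size is $|Q|$. Let $N(n,k)$ be the number of BDDs of index $k$ and size $n$, up to isomorphism. Lists of different lengths are added componentwise, after padding the shorter one with zeros; $\boldsymbol\epsilon$ is the empty list and $\boldsymbol e^{(j)}=(0,\dots,0,1)$ has $j+1$ components. The function $\mathrm{count}(m,\boldsymbol p,s)$, with $\boldsymbol p=(p_0,\dots,p_{j-1})$, returns a dictionary $d$ (keys are lists of natural numbers, values are integers), computed from the empty dictionary as follows. For $i=0,\dots,m-1$: let $d_0=\{\boldsymbol\epsilon:\sum_t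 p_t\}$ if $i=0$, and otherwise let $d_0$ be the union over $1\le k_0\le j-1$ of $\mathrm{count}(i,(p_0,\dots,p_{k_0-1}),p_{k_0})$; for each $(\boldsymbol\ell,w_0)\in d_0$ put $\boldsymbol p'=\boldsymbol p+\boldsymbol\ell$, and let $d_1=\{\boldsymbol\epsilon:-1+\sum_t p'_t\}$ if $m-1-i=0$, and otherwise let $d_1$ be the union over $1\le k_1\le j-1$ of $\mathrm{count}(m-1-i,(p'_0,\dots,p'_{k_1-1}),p'_{k_1})$; for each $(\boldsymbol r,w_1)\in d_1$ put $w=w_0w_1$, replaced by $w-s$ if $m=1$, and if $w>0$ add $w$ to the value of $d$ at the key $\boldsymbol\ell+\boldsymbol r+\boldsymbol e^{(j)}$ (creating the key if it is absent). With memoization, the result of each call is stored, and a call whose arguments have occurred before only looks up the stored result. **Proposition.** For all $n$ and all $k\ge1$, the sum of the values in the dictionary $\mathrm{count}(n-2,(2,0,\dots,0),0)$, where $(2,0,\dots,0)$ has $k$ components and $n-2$ is read as $0$ if $n<2$, equals $N(n,k)$. Moreover, there is a constant $C$ such that for all $k\ge1$ and all $n\le 2^k+1$ (the largest conceivable size of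 a BDD of index $k$), this evaluation of $N(n,k)$ by the algorithm with memoization, starting with an empty table, takes at most $$C\cdot\frac1k\,2^{3k^2/2+k}$$ operations. Here every addition, subtraction, multiplication and comparison of two integers (weights, entries of lists, or sizes) counts as one operation, an operation on lists counts one for each component, and every call, loop iteration and dictionary update counts as one further operation. -/

import Mathlib

/-! ## Binary decision diagrams -/

/-- A (plane, reduced, ordered) binary decision diagram of index `k`, seen as an automaton.
The set of nodes is `Q = Bool ⊕ V`: the two sinks are `⊥ = Sum.inl false` and
`⊤ = Sum.inl true`, and `V` is the set of decision nodes.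
The graph is acyclic because `index` strictly decreases along every edge. -/
structure BDD (V : Type) (k : ℕ) where
  /-- the index function `I : Q → {0, …, k}` -/
  index : Bool ⊕ V → ℕ
  index_le : ∀ q, index q ≤ k
  index_sink : ∀ b, index (Sum.inl b) = 0
  /-- the root -/
  root : Bool ⊕ V
  index_root : index root = k
  /-- the transition function: `δ v false` is the low child and `δ v true` the high child -/
  δ : V → Bool → Bool ⊕ V
  low_ne_high : ∀ v, δ v false ≠ δ v true
  no_duplicate : ∀ u v, u ≠ v → index (Sum.inr u) = index (Sum.inr v) →
    δ u false ≠ δ v false ∨ δ u true ≠ δ v true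
  index_lt : ∀ v b, index (δ v b) < index (Sum.inr v)
  /-- the root is the unique node of in-degree `0` -/
  source_iff : ∀ q, (∀ v b, δ v b ≠ q) ↔ q = root

/-- Two diagrams are the same up to the names of their decision nodes. -/
def BDD.Iso {V W : Type} {k : ℕ} (A : BDD V k) (B : BDD W k) : Prop :=
  ∃ e : V ≃ W,
    (∀ q, B.index (Sum.map id e q) = A.index q) ∧
    B.root = Sum.map id e A.root ∧
    ∀ v b, B.δ (e v) b = Sum.map id e (A.δ v b)

theorem BDD.Iso.equivalence (V : Type) (k : ℕ) :
    Equivalence (BDD.Iso : BDD V k → BDD V k → Prop) where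
  refl A := ⟨Equiv.refl V, by simp⟩
  symm := by
    rintro A B ⟨e, h1, h2, h3⟩
    have hc : ∀ q : Bool ⊕ V, Sum.map id e.symm (Sum.map id e q) = q := by
      rintro (b | v) <;> simp
    have hc' : ∀ q : Bool ⊕ V, Sum.map id e (Sum.map id e.symm q) = q := by
      rintro (b | v) <;> simp
    refine ⟨e.symm, fun q => ?_, ?_, fun v b => ?_⟩
    · rw [← h1, hc']
    · rw [h2, hc]
    · have := h3 (e.symm v) b
      rw [Equiv.apply_symm_apply] at this
      rw [this, hc]
  trans := by
    rintro A B C ⟨e, h1, h2, h3⟩ ⟨f, g1, g2, g3⟩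
    have hc : ∀ q : Bool ⊕ V, Sum.map id f (Sum.map id e q) = Sum.map id (e.trans f) q := by
      rintro (b | v) <;> simp
    refine ⟨e.trans f, fun q => ?_, ?_, fun v b => ?_⟩
    · rw [← hc, g1, h1]
    · rw [g2, h2, hc]
    · rw [Equiv.trans_apply, g3, h3, hc]

/-- Isomorphism of diagrams with the same set of decision nodes. -/
def BDD.isoSetoid (V : Type) (k : ℕ) : Setoid (BDD V k) where
  r := BDD.Iso
  iseqv := BDD.Iso.equivalence V k

/-- `N(n, k)`: the number of diagrams (up to isomorphism) of index `k` and size `n`, that is, with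
`n` nodes, of which `n - 2` are decision nodes. (If `k ≥ 1` then the root is a decision node, so
that the number is `0` for `n ≤ 2`.) -/
noncomputable def numBDD (n k : ℕ) : ℕ :=
  Nat.card (Quotient (BDD.isoSetoid (Fin (n - 2)) k))

/-! ## The counting algorithm with memoization -/

/-- The sum of two lists, the shorter one being padded with zeros. -/
def addProfile : List ℕ → List ℕ → List ℕ
  | [], q => q
  | p, [] => p
  | a :: p, b :: q => (a + b) :: addProfile p q

/-- A dictionary whose keys are profiles and whose values are integers (the weights),
as an association list in the order of insertion. -/
abbrev Dict := List (List ℕ × ℤ)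

/-- `d[t] ← d[t] + w` if `t` is a key of `d`, otherwise `t` becomes a new key with value `w`. -/
def Dict.insertAdd : Dict → List ℕ → ℤ → Dict
  | [], t, w => [(t, w)]
  | (u, x) :: d, t, w =>
    if u = t then (u, x + w) :: d else (u, x) :: Dict.insertAdd d t w

/-- The state of a run: the number of operations performed so far, and the table of the results
stored so far, indexed by the arguments `(n, p, s)` of the calls. -/
structure CountState where
  ops : ℕ
  memo : ℕ × List ℕ × ℕ → Option Dict

abbrev CountM := StateM CountState

/-- Charge `c` operations. One unit is charged for every addition, subtraction, multiplication and
comparison of integers, whether they are weights, entries of profiles or sizes; an operation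
on a list is charged one unit for each component. Moreover every call (look-up in the table), every
iteration of a loop and every update of a dictionary is charged one unit. -/
def tick (c : ℕ) : CountM Unit :=
  modify fun σ => { σ with ops := σ.ops + c }

/-- `∑ pᵢ` -/
def sumM (p : List ℕ) : CountM ℤ := do
  tick p.length
  pure (p.sum : ℤ)

/-- `p + q` -/
def addProfileM (p q : List ℕ) : CountM (List ℕ) := do
  tick (max p.length q.length)
  pure (addProfile p q)

/-- The memoized function `count(n, p, s)`, where `p = (p₀, …, p_{k-1})` is the pool profile and `s`
the level rank of a root of index `k = p.length`. A call whose arguments are in the table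
returns the stored result; otherwise the result is computed and stored.
The variables `a` and `b` stand for `k₀ - 1` and `k₁ - 1`, where `1 ≤ k₀, k₁ ≤ k - 1` is the
index of the root of the left and of the right subtree. The dictionaries that are collected for
different values of `k₀` (or `k₁`) have keys of different lengths, so that their union is `++`. -/
def countM (n : ℕ) (p : List ℕ) (s : ℕ) : CountM Dict := do
  tick 1
  match (← get).memo (n, p, s) with
  | some d => pure d
  | none =>
    let d ← (List.range n).foldlM (init := ([] : Dict)) fun d i => do
      -- loop counter, and the test `i = 0`
      tick 2
      let d₀ ←
        (if i = 0 then do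
          let w ← sumM p
          pure [(([] : List ℕ), w)]
        else
          (List.finRange (p.length - 1)).foldlM (init := ([] : Dict)) fun d₀ a => do
            tick 1
            let c ← countM i (p.take (a.val + 1)) (p.getD (a.val + 1) 0)
            pure (d₀ ++ c))
      d₀.foldlM (init := d) fun d (ℓ, w₀) => do
        tick 1
        let p' ← addProfileM p ℓ
        -- the size `n - 1 - i`, and its comparison with `0`
        tick 3
        let d₁ ←
          (if n - 1 - i = 0 then do
            let w ← sumM p'
            tick 1
            pure [(([] : List ℕ), -1 + w)]
          else
            (List.finRange (p.length - 1)).foldlM (init := ([] : Dict)) fun d₁ b => do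
              tick 1
              let c ← countM (n - 1 - i) (p'.take (b.val + 1)) (p'.getD (b.val + 1) 0)
              pure (d₁ ++ c))
        d₁.foldlM (init := d) fun d (r, w₁) => do
          -- iteration, product, the test `n = 1`, the test `w > 0`
          tick 4
          let w ← (if n = 1 then do
              tick 1
              pure (w₀ * w₁ - (s : ℤ))
            else pure (w₀ * w₁))
          if 0 < w then do
            let u ← addProfileM ℓ r
            let t ← addProfileM u (List.replicate p.length 0 ++ [1])
            -- addition `d[t] + w`, and update of the dictionary
            tick 2
            pure (Dict.insertAdd d t w)
          else pure d
    modify fun σ => { σ with memo := Function.update σ.memo (n, p, s) (some d) }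
    pure d
termination_by p.length
decreasing_by
  · simp only [List.length_take]; omega
  · simp only [List.length_take]; omega

/-- The evaluation of `N(n, k)`: the sum of the values in the dictionary
`count(n - 2, (2, 0, …, 0), 0)`, where `(2, 0, …, 0)` has `k` components. -/
def evalM (n k : ℕ) : CountM ℤ := do
  tick 1
  let d ← countM (n - 2) (2 :: List.replicate (k - 1) 0) 0
  tick d.length
  pure (d.map Prod.snd).sum

/-- The run of the evaluation of `N(n, k)` that starts with an empty table: the
value returned and the final state. -/
def evalRun (n k : ℕ) : ℤ × CountState :=
  (evalM n k).run { ops := 0, memo := fun _ => none }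

/-- The value returned by the algorithm. -/
def countValue (n k : ℕ) : ℤ := (evalRun n k).1

/-- The total number of operations performed by the algorithm. -/
def countOps (n k : ℕ) : ℕ := (evalRun n k).2.ops

/-! ## The memoized run and its pure counterpart -/

/-! A diagram is determined up to isomorphism by its decision nodes in the postorder of a
depth-first search, each recorded with its index and the references to its children
(`BDD.iso_of_canon_eq`). The lists so obtained are exactly those generated by `visits`
(`BDD.canon_mem_visits`, `canon_decode`), and none is generated twice (`nodup_visits`); hence
`numBDD_eq_length_visits`.

The number of ways to continue a visit depends on the pool of nodes already found only through its
level sizes. A pointer into the pool can aim at any node of smaller index; a high pointer loses one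
target, the low child. A node with a newly found child cannot duplicate a pool node, while a node
with both children in the pool must avoid the pairs taken by the `s` pool nodes of its own index.
Therefore profiles carry enough information, and `counts` shows by induction on the index that the
dictionary is the distribution of the profiles of new nodes over all visits.

The cost is amortized: in `Spec` each new table entry pays for `X` operations, so the total is about
`X` times the number of possible arguments. Binary branching bounds the keys (`keyBound_countDict`),
and a reserve in the profile bounds keeps all arguments in a box (`ValidCall.child`). With `Q =
profileBound k`, there are at most `2^k * k * Q` arguments, and a body costs `O(2^k * k * (k *
Q)^2)`. Since `Q = O(2^(k(k-1)/2))`, the product is `O(k^4 * 2^(3k²/2 + k/2))`; the spare factor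
`2^(k/2)` absorbs `k^5`, which leaves the factor `1/k`. -/

/-- Insert all the entries of a list into an empty dictionary. -/
def Dict.collect (l : List (List ℕ × ℤ)) : Dict :=
  l.foldl (fun d e => Dict.insertAdd d e.1 e.2) []

/-- The result of `countM`, without the memoization. -/
def countDict (n : ℕ) (p : List ℕ) (s : ℕ) : Dict :=
  Dict.collect <| (List.range n).flatMap fun i =>
    (if i = 0 then [(([] : List ℕ), (p.sum : ℤ))] else
      (List.finRange (p.length - 1)).flatMap fun a =>
        countDict i (p.take (a.val + 1)) (p.getD (a.val + 1) 0)).flatMap fun x =>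
    (if n - 1 - i = 0 then [(([] : List ℕ), -1 + ((addProfile p x.1).sum : ℤ))] else
      (List.finRange (p.length - 1)).flatMap fun b =>
        countDict (n - 1 - i) ((addProfile p x.1).take (b.val + 1))
          ((addProfile p x.1).getD (b.val + 1) 0)).flatMap fun y =>
    if 0 < (if n = 1 then x.2 * y.2 - (s : ℤ) else x.2 * y.2) then
      [(addProfile (addProfile x.1 y.1) (List.replicate p.length 0 ++ [1]),
        if n = 1 then x.2 * y.2 - (s : ℤ) else x.2 * y.2)]
    else []
termination_by p.length
decreasing_by
  · simp only [List.length_take]; omega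
  · simp only [List.length_take]; omega

/-- The dictionary collected for one child of size `i`; `w` is the weight of a pointer, and `j` is
the index of the parent. -/
def childDict (j i : ℕ) (p : List ℕ) (w : ℤ) : Dict :=
  if i = 0 then [([], w)] else
    (List.finRange (j - 1)).flatMap fun a =>
      countDict i (p.take (a.val + 1)) (p.getD (a.val + 1) 0)

/-- The contribution of a pair of children. -/
def nodeEntry (n j s : ℕ) (x y : List ℕ × ℤ) : List (List ℕ × ℤ) :=
  if 0 < (if n = 1 then x.2 * y.2 - (s : ℤ) else x.2 * y.2) then
    [(addProfile (addProfile x.1 y.1) (List.replicate j 0 ++ [1]),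
      if n = 1 then x.2 * y.2 - (s : ℤ) else x.2 * y.2)]
  else []

theorem countDict_eq (n : ℕ) (p : List ℕ) (s : ℕ) :
    countDict n p s = Dict.collect ((List.range n).flatMap fun i =>
      (childDict p.length i p p.sum).flatMap fun x =>
      (childDict p.length (n - 1 - i) (addProfile p x.1) (-1 + (addProfile p x.1).sum)).flatMap
        fun y => nodeEntry n p.length s x y) := by
  rw [countDict]; rfl

/-- All stored results are correct. -/
def CountState.Good (σ : CountState) : Prop :=
  ∀ t d, σ.memo t = some d → d = countDict t.1 t.2.1 t.2.2

/-- The number of results in the table, for arguments in `V`. -/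
def CountState.stored (V : Finset (ℕ × List ℕ × ℕ)) (σ : CountState) : ℕ :=
  (V.filter fun t => (σ.memo t).isSome).card

/-- The program `x` returns `a` and takes at most `c` operations, not counting `X` operations for
each new entry of the table; it does not touch entries for profiles of length at least `ℓ`. -/
def Spec (V : Finset (ℕ × List ℕ × ℕ)) (X ℓ : ℕ) {α : Type} (x : CountM α) (a : α) (c : ℕ) :
    Prop :=
  ∀ σ : CountState, σ.Good → (x.run σ).1 = a ∧ (x.run σ).2.Good ∧
    (x.run σ).2.ops + X * σ.stored V ≤ σ.ops + c + X * (x.run σ).2.stored V ∧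
    ∀ t, ℓ ≤ t.2.1.length → (x.run σ).2.memo t = σ.memo t

/-! ### Rules for costs amortized over the table -/

namespace Spec

variable {V : Finset (ℕ × List ℕ × ℕ)} {X ℓ : ℕ} {α β : Type}

theorem mono {x : CountM α} {a : α} {c c' ℓ' : ℕ} (h : Spec V X ℓ x a c) (hc : c ≤ c')
    (hl : ℓ ≤ ℓ') : Spec V X ℓ' x a c' := by
  intro σ hσ
  obtain ⟨h1, h2, h3, h4⟩ := h σ hσ
  exact ⟨h1, h2, by omega, fun t ht => h4 t (by omega)⟩

theorem of_pure (a : α) : Spec V X ℓ (pure a : CountM α) a 0 :=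
  fun _ hσ => ⟨rfl, hσ, le_refl _, fun _ _ => rfl⟩

theorem of_tick (c : ℕ) : Spec V X ℓ (tick c) () c :=
  fun _ hσ => ⟨rfl, hσ, le_refl _, fun _ _ => rfl⟩

theorem bind {x : CountM α} {f : α → CountM β} {a : α} {b : β} {c c' : ℕ}
    (hx : Spec V X ℓ x a c) (hf : Spec V X ℓ (f a) b c') :
    Spec V X ℓ (x >>= f) b (c + c') := by
  intro σ hσ
  obtain ⟨h1, h2, h3, h4⟩ := hx σ hσ
  obtain ⟨g1, g2, g3, g4⟩ := hf _ h2
  have e : (x >>= f).run σ = (f a).run (x.run σ).2 := by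
    rw [← h1]; rfl
  rw [e]
  exact ⟨g1, g2, by omega, fun t ht => (g4 t ht).trans (h4 t ht)⟩

theorem bind_le {x : CountM α} {f : α → CountM β} {a : α} {b : β} {c c' C : ℕ}
    (hx : Spec V X ℓ x a c) (hf : Spec V X ℓ (f a) b c') (hC : c + c' ≤ C) :
    Spec V X ℓ (x >>= f) b C :=
  (hx.bind hf).mono hC (le_refl _)

theorem pure_le (a : α) {c : ℕ} : Spec V X ℓ (pure a : CountM α) a c :=
  (of_pure a).mono (Nat.zero_le _) (le_refl _)

theorem of_foldlM {f : β → α → CountM β} {F : β → α → β} {c : ℕ} (l : List α)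
    (h : ∀ b, ∀ x ∈ l, Spec V X ℓ (f b x) (F b x) c) (b : β) :
    Spec V X ℓ (l.foldlM f b) (l.foldl F b) (l.length * c) := by
  induction l generalizing b with
  | nil => simpa using Spec.of_pure b
  | cons x l ih =>
    rw [List.foldlM_cons, List.foldl_cons, List.length_cons, add_mul, one_mul, add_comm]
    exact (h b x (by simp)).bind (ih (fun b y hy => h b y (by simp [hy])) _)

theorem of_sumM (p : List ℕ) : Spec V X ℓ (sumM p) (p.sum : ℤ) p.length :=
  bind_le (of_tick _) (of_pure _) (le_refl _)

theorem of_addProfileM (p q : List ℕ) :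
    Spec V X ℓ (addProfileM p q) (addProfile p q) (max p.length q.length) :=
  bind_le (of_tick _) (of_pure _) (le_refl _)

/-- A loop that collects the dictionaries for the possible indices of a child. -/
theorem childLoop {j i c : ℕ} {p : List ℕ}
    (h : ∀ a : Fin (j - 1), Spec V X ℓ (countM i (p.take (a.val + 1)) (p.getD (a.val + 1) 0))
      (countDict i (p.take (a.val + 1)) (p.getD (a.val + 1) 0)) c) :
    Spec V X ℓ
      ((List.finRange (j - 1)).foldlM (init := ([] : Dict)) fun d₀ a => do
        tick 1
        let c ← countM i (p.take (a.val + 1)) (p.getD (a.val + 1) 0)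
        pure (d₀ ++ c))
      ((List.finRange (j - 1)).flatMap fun a =>
        countDict i (p.take (a.val + 1)) (p.getD (a.val + 1) 0))
      ((j - 1) * (1 + c)) := by
  have e : ((List.finRange (j - 1)).flatMap fun a =>
        countDict i (p.take (a.val + 1)) (p.getD (a.val + 1) 0)) =
      (List.finRange (j - 1)).foldl (fun d a => d ++
        countDict i (p.take (a.val + 1)) (p.getD (a.val + 1) 0)) [] := by
    rw [List.flatMap_eq_foldl]
  rw [e]
  have := Spec.of_foldlM (V := V) (X := X) (ℓ := ℓ) (c := 1 + c) (List.finRange (j - 1))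
    (f := fun (d₀ : Dict) (a : Fin (j - 1)) => (do
        tick 1
        let c ← countM i (p.take (a.val + 1)) (p.getD (a.val + 1) 0)
        pure (d₀ ++ c) : CountM Dict))
    (F := fun d a => d ++ countDict i (p.take (a.val + 1)) (p.getD (a.val + 1) 0))
    (fun d a _ => Spec.bind_le (of_tick 1) (bind_le (h a) (of_pure _) (le_refl _)) (le_refl _)) []
  rwa [List.length_finRange] at this

end Spec

theorem length_addProfile : ∀ p q : List ℕ, (addProfile p q).length = max p.length q.length
  | [], q => by simp [addProfile]
  | a :: p, [] => by simp [addProfile]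
  | a :: p, b :: q => by simp [addProfile, length_addProfile p q, Nat.succ_max_succ]

/-- The body of the innermost loop. -/
theorem Spec.inner {V : Finset (ℕ × List ℕ × ℕ)} {X ℓ n j s : ℕ} (d : Dict)
    (x y : List ℕ × ℤ) (hx : x.1.length ≤ j) (hy : y.1.length ≤ j) :
    Spec V X ℓ (do
      tick 4
      let w ← (if n = 1 then do
          tick 1
          pure (x.2 * y.2 - (s : ℤ))
        else pure (x.2 * y.2))
      if 0 < w then do
        let u ← addProfileM x.1 y.1
        let t ← addProfileM u (List.replicate j 0 ++ [1])
        tick 2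
        pure (Dict.insertAdd d t w)
      else pure d)
      ((nodeEntry n j s x y).foldl (fun d e => Dict.insertAdd d e.1 e.2) d) (2 * j + 8) := by
  have e : nodeEntry n j s x y = if 0 < (if n = 1 then x.2 * y.2 - (s : ℤ) else x.2 * y.2) then
    [(addProfile (addProfile x.1 y.1) (List.replicate j 0 ++ [1]),
      if n = 1 then x.2 * y.2 - (s : ℤ) else x.2 * y.2)] else [] := rfl
  refine Spec.bind_le (c' := 2 * j + 4) (Spec.of_tick 4) (Spec.bind_le (c := 1) (c' := 2 * j + 3)
    (a := if n = 1 then x.2 * y.2 - (s : ℤ) else x.2 * y.2) ?_ ?_ (by omega)) (by omega)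
  · split_ifs
    · exact Spec.bind_le (Spec.of_tick 1) (Spec.of_pure _) (le_refl _)
    · exact Spec.pure_le _
  · rw [e]
    by_cases hw : 0 < (if n = 1 then x.2 * y.2 - (s : ℤ) else x.2 * y.2)
    · rw [if_pos hw, if_pos hw]
      refine Spec.bind_le (Spec.of_addProfileM _ _) (Spec.bind_le (Spec.of_addProfileM _ _)
        (Spec.bind_le (Spec.of_tick 2) (Spec.of_pure _) (le_refl _)) (le_refl _)) ?_
      simp only [length_addProfile, List.length_append, List.length_replicate, List.length_cons,
        List.length_nil]
      omega
    · rw [if_neg hw, if_neg hw]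
      exact Spec.pure_le _

/-- Storing the result of a call whose arguments are not in the table yet. -/
theorem Spec.memoize {V : Finset (ℕ × List ℕ × ℕ)} {X n s c : ℕ} {p : List ℕ}
    (hV : (n, p, s) ∈ V) {x : CountM Dict} (hx : Spec V X p.length x (countDict n p s) c)
    (hc : c ≤ X) :
    Spec V X (p.length + 1) (do
      tick 1
      match (← get).memo (n, p, s) with
      | some d => pure d
      | none =>
        let d ← x
        modify fun σ => { σ with memo := Function.update σ.memo (n, p, s) (some d) }
        pure d) (countDict n p s) 1 := by
  refine Spec.bind_le (c' := 0) (Spec.of_tick 1) ?_ (le_refl _)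
  intro σ hσ
  set m : CountM Dict := do
    let d ← x
    modify fun σ => { σ with memo := Function.update σ.memo (n, p, s) (some d) }
    pure d with hm'
  have e : (do
      match (← get).memo (n, p, s) with
      | some d => pure d
      | none => m : CountM Dict).run σ =
        (match σ.memo (n, p, s) with
          | some d => (pure d : CountM Dict)
          | none => m).run σ := rfl
  rw [e]
  rcases hm : σ.memo (n, p, s) with _ | d
  · obtain ⟨h1, h2, h3, h4⟩ := hx σ hσ
    have e' : m.run σ = (countDict n p s, { (x.run σ).2 with
        memo := Function.update (x.run σ).2.memo (n, p, s) (some (countDict n p s)) }) := by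
      rw [← h1]; rfl
    simp only [e']
    refine ⟨trivial, ?_, ?_, ?_⟩
    · intro t d ht
      by_cases h : t = (n, p, s)
      · subst h
        simpa using ht.symm
      · simp only [Function.update_of_ne h] at ht
        exact h2 t d ht
    -- The body only touches entries for shorter profiles, so this entry is still absent afterwards.
    -- Storing it raises the potential by exactly `X`, which pays for the body.
    · have hnew : ((x.run σ).2.memo (n, p, s)) = none := by rw [h4 _ (le_refl _), hm]
      have hcard : CountState.stored V { (x.run σ).2 with
          memo := Function.update (x.run σ).2.memo (n, p, s) (some (countDict n p s)) } =
          (x.run σ).2.stored V + 1 := by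
        have : (V.filter fun t => (Function.update (x.run σ).2.memo (n, p, s)
            (some (countDict n p s)) t).isSome) =
            insert (n, p, s) (V.filter fun t => ((x.run σ).2.memo t).isSome) := by
          ext t
          by_cases h : t = (n, p, s)
          · subst h; simp [hV]
          · simp [h]
        unfold CountState.stored
        simp only [this]
        rw [Finset.card_insert_of_notMem (by simp [hnew])]
      simp only [hcard]
      rw [mul_add]
      omega
    · intro t ht
      have h : t ≠ (n, p, s) := by rintro rfl; simp at ht
      simp only [Function.update_of_ne h]
      exact h4 t (by omega)
  · have hd := hσ _ _ hm
    subst hd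
    exact ⟨rfl, hσ, le_refl _, fun _ _ => rfl⟩

/-- This is the local cost analysis: recursive calls are charged one unit each, and all the
remaining work of the three nested loops fits into the `X` operations granted for the new entry. `A`
and `B` bound the dictionaries of the left and right child. -/
theorem Spec.countM_of_body {V : Finset (ℕ × List ℕ × ℕ)} {X n s : ℕ} {p : List ℕ}
    (hV : (n, p, s) ∈ V) (hp : 1 ≤ p.length) {A B : ℕ}
    (h0 : ∀ i < n, 0 < i → ∀ a < p.length - 1,
      Spec V X p.length (countM i (p.take (a + 1)) (p.getD (a + 1) 0))
        (countDict i (p.take (a + 1)) (p.getD (a + 1) 0)) 1)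
    (h1 : ∀ i < n, 0 < n - 1 - i → ∀ x ∈ childDict p.length i p p.sum, ∀ a < p.length - 1,
      Spec V X p.length (countM (n - 1 - i) ((addProfile p x.1).take (a + 1))
          ((addProfile p x.1).getD (a + 1) 0))
        (countDict (n - 1 - i) ((addProfile p x.1).take (a + 1))
          ((addProfile p x.1).getD (a + 1) 0)) 1)
    (hA : ∀ i < n, (childDict p.length i p p.sum).length ≤ A)
    (hB : ∀ i < n, ∀ x ∈ childDict p.length i p p.sum,
      (childDict p.length (n - 1 - i) (addProfile p x.1)
        (-1 + (addProfile p x.1).sum)).length ≤ B)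
    (hA' : ∀ i < n, ∀ x ∈ childDict p.length i p p.sum, x.1.length ≤ p.length)
    (hB' : ∀ i < n, ∀ x ∈ childDict p.length i p p.sum,
      ∀ y ∈ childDict p.length (n - 1 - i) (addProfile p x.1)
        (-1 + (addProfile p x.1).sum), y.1.length ≤ p.length)
    (hX : n * (2 + 2 * p.length + A * (3 * p.length + 5 + B * (2 * p.length + 8))) ≤ X) :
    Spec V X (p.length + 1) (countM n p s) (countDict n p s) 1 := by
  rw [countM]
  refine Spec.memoize (c := n * (2 + 2 * p.length + A * (3 * p.length + 5 +
    B * (2 * p.length + 8)))) hV ?_ hX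
  have hlen : n = (List.range n).length := by simp
  rw [countDict_eq, Dict.collect, List.foldl_flatMap]
  -- Only the outer factor of the cost is rewritten, to match the form `l.length * c` of the loop
  -- rule.
  conv => arg 6; rw [hlen]
  refine Spec.of_foldlM _ (fun d i hi => ?_) _
  rw [List.mem_range] at hi
  rw [List.foldl_flatMap]
  refine Spec.bind_le (Spec.of_tick 2) (Spec.bind_le (c := 2 * p.length)
    (a := childDict p.length i p p.sum) ?_
    ((Spec.of_foldlM _ (c := 3 * p.length + 5 + B * (2 * p.length + 8))
      (fun d x hx => ?_) _).mono (Nat.mul_le_mul_right _ (hA i hi)) (le_refl _)) (le_refl _)) ?_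
  · unfold childDict
    split_ifs with h
    · exact Spec.bind_le (Spec.of_sumM _) (Spec.of_pure _) (by omega)
    · exact (Spec.childLoop (c := 1) fun a => h0 i hi (by omega) a a.2).mono (by omega) (le_refl _)
  · rw [List.foldl_flatMap]
    refine Spec.bind_le (Spec.of_tick 1) (Spec.bind_le (Spec.of_addProfileM _ _)
      (Spec.bind_le (Spec.of_tick 3) (Spec.bind_le (c := 2 * p.length + 1)
    (a := childDict p.length (n - 1 - i) (addProfile p x.1) (-1 + (addProfile p x.1).sum)) ?_
    ((Spec.of_foldlM _ (c := 2 * p.length + 8)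
      (fun d y hy => ?_) _).mono (Nat.mul_le_mul_right _ (hB i hi x hx)) (le_refl _))
        (le_refl _)) (le_refl _)) (le_refl _)) ?_
    · unfold childDict
      split_ifs with h
      · refine Spec.bind_le (Spec.of_sumM _) (Spec.bind_le (Spec.of_tick 1) (Spec.of_pure _) (le_refl _)) ?_
        have := hA' i hi x hx
        rw [length_addProfile]
        omega
      · exact (Spec.childLoop (c := 1) fun a => h1 i hi (by omega) x hx a a.2).mono (by omega)
          (le_refl _)
    · exact Spec.inner d x y (hA' i hi x hx) (hB' i hi x hx y hy)
    · have := hA' i hi x hx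
      omega
  · omega

/-! ## Dictionaries -/

/-- The sum of a function over the keys of a dictionary, with weights. -/
def Dict.wsum (d : Dict) (g : List ℕ → ℤ) : ℤ := (d.map fun e => e.2 * g e.1).sum

theorem Dict.wsum_insertAdd (d : Dict) (t : List ℕ) (w : ℤ) (g : List ℕ → ℤ) :
    (d.insertAdd t w).wsum g = d.wsum g + w * g t := by
  induction d with
  | nil => simp [Dict.insertAdd, Dict.wsum]
  | cons e d ih =>
    obtain ⟨u, x⟩ := e
    simp only [Dict.insertAdd]
    split_ifs with h
    · subst h; simp [Dict.wsum]; ring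
    · simp only [Dict.wsum, List.map_cons, List.sum_cons] at ih ⊢
      rw [ih]; ring

/-- Merging entries with equal keys is invisible to a weighted sum, so from here on dictionaries can
be treated as plain lists of contributions. -/
theorem Dict.wsum_collect (l : List (List ℕ × ℤ)) (g : List ℕ → ℤ) :
    (Dict.collect l).wsum g = (l.map fun e => e.2 * g e.1).sum := by
  have : ∀ d : Dict, (l.foldl (fun d e => Dict.insertAdd d e.1 e.2) d).wsum g =
      d.wsum g + (l.map fun e => e.2 * g e.1).sum := by
    induction l with
    | nil => simp
    | cons e l ih =>
      intro d
      rw [List.foldl_cons, ih, Dict.wsum_insertAdd, List.map_cons, List.sum_cons]; ring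
  exact (this []).trans (zero_add _)

theorem Dict.mem_insertAdd {d : Dict} {t : List ℕ} {w : ℤ} {e : List ℕ × ℤ}
    (he : e ∈ d.insertAdd t w) :
    e ∈ d ∨ (e = (t, w) ∨ ∃ x, (t, x) ∈ d ∧ e = (t, x + w)) := by
  induction d with
  | nil => simp only [Dict.insertAdd, List.mem_singleton] at he; simp [he]
  | cons f d ih =>
    obtain ⟨u, x⟩ := f
    simp only [Dict.insertAdd] at he
    split_ifs at he with h
    · subst h
      rcases List.mem_cons.1 he with rfl | he
      · exact Or.inr (Or.inr ⟨x, by simp, rfl⟩)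
      · exact Or.inl (List.mem_cons_of_mem _ he)
    · rcases List.mem_cons.1 he with rfl | he
      · simp
      · rcases ih he with h1 | h1 | ⟨y, h1, h2⟩
        · exact Or.inl (List.mem_cons_of_mem _ h1)
        · exact Or.inr (Or.inl h1)
        · exact Or.inr (Or.inr ⟨y, List.mem_cons_of_mem _ h1, h2⟩)

theorem Dict.collect_induction {P : List ℕ × ℤ → Prop} {l : List (List ℕ × ℤ)}
    (hl : ∀ e ∈ l, P e) (hP : ∀ t x w, P (t, x) → P (t, w) → P (t, x + w)) :
    ∀ e ∈ Dict.collect l, P e := by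
  have : ∀ d : Dict, (∀ e ∈ d, P e) →
      ∀ e ∈ l.foldl (fun d e => Dict.insertAdd d e.1 e.2) d, P e := by
    induction l with
    | nil => exact fun d hd => hd
    | cons f l ih =>
      intro d hd
      refine ih (fun e he => hl e (by simp [he])) _ fun e he => ?_
      have hf := hl f (by simp)
      rcases Dict.mem_insertAdd he with h | rfl | ⟨x, h1, rfl⟩
      · exact hd e h
      · exact hf
      · exact hP _ _ _ (hd _ h1) hf
  exact this [] (by simp)

theorem Dict.nodup_insertAdd {d : Dict} (t : List ℕ) (w : ℤ) (hd : (d.map Prod.fst).Nodup) :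
    ((d.insertAdd t w).map Prod.fst).Nodup := by
  induction d with
  | nil => simp [Dict.insertAdd]
  | cons f d ih =>
    obtain ⟨u, x⟩ := f
    simp only [List.map_cons, List.nodup_cons] at hd
    simp only [Dict.insertAdd]
    split_ifs with h
    · simpa using hd
    · simp only [List.map_cons, List.nodup_cons]
      refine ⟨fun hm => ?_, ih hd.2⟩
      obtain ⟨e, he, h1⟩ := List.mem_map.1 hm
      rcases Dict.mem_insertAdd he with h2 | rfl | ⟨y, h2, rfl⟩
      · exact hd.1 (List.mem_map.2 ⟨e, h2, h1⟩)
      · exact h h1.symm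
      · exact h h1.symm

theorem Dict.nodup_collect (l : List (List ℕ × ℤ)) :
    ((Dict.collect l).map Prod.fst).Nodup := by
  have : ∀ d : Dict, (d.map Prod.fst).Nodup →
      ((l.foldl (fun d e => Dict.insertAdd d e.1 e.2) d).map Prod.fst).Nodup := by
    induction l with
    | nil => exact fun d hd => hd
    | cons f l ih => exact fun d hd => ih _ (Dict.nodup_insertAdd _ _ hd)
  exact this [] (by simp)

theorem getD_addProfile (p q : List ℕ) (t : ℕ) :
    (addProfile p q).getD t 0 = p.getD t 0 + q.getD t 0 := by
  induction p generalizing q t with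
  | nil => simp [addProfile]
  | cons a p ih =>
    cases q with
    | nil => simp [addProfile]
    | cons b q =>
      cases t with
      | zero => simp [addProfile]
      | succ t => simpa [addProfile] using ih q t

theorem addProfile_nil (p : List ℕ) : addProfile p [] = p := by
  cases p <;> simp [addProfile]

/-! ## The size of the keys -/

/-- The bounds for the keys of a dictionary for trees whose root has index `j`. -/
def KeyBound (j : ℕ) (l : List ℕ) : Prop :=
  l.length = j + 1 ∧ l.getD 0 0 = 0 ∧ ∀ t, 1 ≤ t → t ≤ j → l.getD t 0 ≤ 2 ^ (j - t)

/-- The bounds for the keys of a dictionary for the children of a node of index `j`. -/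
def ChildBound (j : ℕ) (l : List ℕ) : Prop :=
  l.length ≤ j ∧ l.getD 0 0 = 0 ∧ ∀ t, 1 ≤ t → t < j → l.getD t 0 ≤ 2 ^ (j - 1 - t)

theorem childBound_nil (j : ℕ) : ChildBound j [] := by
  simp [ChildBound]

theorem KeyBound.childBound {j a : ℕ} {l : List ℕ} (h : KeyBound a l) (ha : a < j) :
    ChildBound j l := by
  obtain ⟨h1, h2, h3⟩ := h
  refine ⟨by omega, h2, fun t ht htj => ?_⟩
  by_cases hta : t ≤ a
  · exact (h3 t ht hta).trans (Nat.pow_le_pow_right (by norm_num) (by omega))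
  · rw [List.getD_eq_default _ _ (by omega)]
    exact Nat.zero_le _

theorem mem_childDict {j i : ℕ} {p : List ℕ} {w : ℤ} {x : List ℕ × ℤ}
    (hx : x ∈ childDict j i p w) : x = ([], w) ∨
      ∃ a < j - 1, x ∈ countDict i (p.take (a + 1)) (p.getD (a + 1) 0) := by
  unfold childDict at hx
  split_ifs at hx
  · exact Or.inl (by simpa using hx)
  · obtain ⟨a, -, h⟩ := List.mem_flatMap.1 hx
    exact Or.inr ⟨a, a.2, h⟩

theorem mem_nodeEntry {n j s : ℕ} {x y e : List ℕ × ℤ} (he : e ∈ nodeEntry n j s x y) :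
    e.1 = addProfile (addProfile x.1 y.1) (List.replicate j 0 ++ [1]) ∧ 0 < e.2 := by
  unfold nodeEntry at he
  by_cases h : 0 < (if n = 1 then x.2 * y.2 - (s : ℤ) else x.2 * y.2)
  · rw [if_pos h, List.mem_singleton] at he
    rw [he]
    exact ⟨rfl, h⟩
  · rw [if_neg h] at he
    simp at he

theorem childBound_of_countDict {j : ℕ} {p : List ℕ} (hp : p.length = j)
    (ih : ∀ a < j, ∀ (n : ℕ) (p : List ℕ) (s : ℕ), 1 ≤ p.length → p.length = a →
      ∀ e ∈ countDict n p s, KeyBound a e.1) (i : ℕ) (w : ℤ) :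
    ∀ x ∈ childDict j i p w, ChildBound j x.1 := by
  intro x hx
  rcases mem_childDict hx with rfl | ⟨a, ha, h⟩
  · exact childBound_nil j
  · exact (ih (a + 1) (by omega) i _ _ (by simp; omega) (by simp; omega) x h).childBound (by omega)

theorem getD_unit (j t : ℕ) : (List.replicate j 0 ++ [1]).getD t 0 = if t = j then 1 else 0 := by
  rcases lt_trichotomy t j with h | h | h
  · rw [List.getD_append _ _ _ _ (by simpa using h), if_neg (by omega)]
    simp [h]
  · subst h
    rw [List.getD_append_right _ _ _ _ (by simp)]
    simp
  · rw [List.getD_eq_default _ _ (by simp; omega), if_neg (by omega)]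

/-- Below a node of index `j` there are two children of index at most `j - 1`, each contributing at
most `2 ^ (j - 1 - t)` new nodes at level `t`. At level `j` only the node itself is counted. -/
theorem keyBound_countDict (n : ℕ) (p : List ℕ) (s : ℕ) (hp : 1 ≤ p.length) :
    ∀ e ∈ countDict n p s, KeyBound p.length e.1 := by
  obtain ⟨j, hj⟩ : ∃ j, p.length = j := ⟨_, rfl⟩
  rw [hj]
  induction j using Nat.strong_induction_on generalizing n p s with
  | _ j ih =>
    rw [countDict_eq]
    refine Dict.collect_induction (P := fun e => KeyBound j e.1) (fun e he => ?_)
      fun t x w h _ => h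
    simp only [List.mem_flatMap, hj] at he
    obtain ⟨i, -, x, hx, y, hy, he⟩ := he
    rw [(mem_nodeEntry he).1]
    have hrec : ∀ a < j, ∀ (n : ℕ) (p : List ℕ) (s : ℕ), 1 ≤ p.length → p.length = a →
        ∀ e ∈ countDict n p s, KeyBound a e.1 := fun a ha n p s h1 h2 => ih a ha n p s h1 h2
    obtain ⟨x1, x2, x3⟩ := childBound_of_countDict hj hrec _ _ x hx
    have hlen : (addProfile p x.1).length = j := by rw [length_addProfile]; omega
    obtain ⟨y1, y2, y3⟩ := childBound_of_countDict hlen hrec _ _ y hy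
    refine ⟨?_, ?_, fun t ht htj => ?_⟩
    · simp only [length_addProfile, List.length_append, List.length_replicate, List.length_cons,
        List.length_nil]
      omega
    · rw [getD_addProfile, getD_addProfile, getD_unit, x2, y2, if_neg (by omega)]
    · rw [getD_addProfile, getD_addProfile, getD_unit]
      rcases htj.eq_or_lt with rfl | htj
      · rw [List.getD_eq_default _ _ x1, List.getD_eq_default _ _ y1]; simp
      · have e : 2 ^ (j - t) = 2 ^ (j - 1 - t) + 2 ^ (j - 1 - t) := by
          rw [← two_mul, ← pow_succ']; congr 1; omega
        have := x3 t ht htj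
        have := y3 t ht htj
        rw [if_neg (by omega)]
        omega

theorem childBound_childDict (i : ℕ) (p : List ℕ) (w : ℤ) :
    ∀ x ∈ childDict p.length i p w, ChildBound p.length x.1 :=
  childBound_of_countDict rfl
    (fun _ _ n q s h1 h2 e he => h2 ▸ keyBound_countDict n q s h1 e he) i w

/-! ## The arguments of the calls -/

/-- The bounds for the arguments of the calls that occur in the evaluation of `N(n, k)`. -/
def ValidCall (k N : ℕ) (c : ℕ × List ℕ × ℕ) : Prop :=
  c.1 ≤ N ∧ 1 ≤ c.2.1.length ∧ c.2.1.length ≤ k ∧ c.2.1.getD 0 0 ≤ 2 ∧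
    (∀ t, 1 ≤ t → t < c.2.1.length → c.2.1.getD t 0 + 2 ^ (c.2.1.length - t) ≤ 2 ^ (k - t)) ∧
    c.2.2 + 1 ≤ 2 ^ (k - c.2.1.length)

/-- In `ValidCall`, the summand `2 ^ (p.length - t)` is room reserved at level `t` for the subtree
about to be built. The left subtree uses at most half of it, and the other half suffices for the
next call. The left call itself is the case `l = []`. -/
theorem ValidCall.child {k N m i s a : ℕ} {p l : List ℕ} (h : ValidCall k N (m, p, s))
    (hl : ChildBound p.length l) (hi : i ≤ N) (ha : a < p.length - 1) :
    ValidCall k N (i, (addProfile p l).take (a + 1), (addProfile p l).getD (a + 1) 0) := by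
  obtain ⟨-, -, h3, h4, h5, -⟩ := h
  obtain ⟨l1, l2, l3⟩ := hl
  dsimp only at h3 h4 h5
  have hlen : (addProfile p l).length = p.length := by rw [length_addProfile]; omega
  have hlen' : ((addProfile p l).take (a + 1)).length = a + 1 := by
    rw [List.length_take]; omega
  have key : ∀ t, 1 ≤ t → t < p.length →
      (addProfile p l).getD t 0 + 2 ^ (p.length - 1 - t) ≤ 2 ^ (k - t) := by
    intro t ht htp
    have e : 2 ^ (p.length - t) = 2 ^ (p.length - 1 - t) + 2 ^ (p.length - 1 - t) := by
      rw [← two_mul, ← pow_succ']; congr 1; omega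
    have := h5 t ht htp
    have := l3 t ht htp
    rw [getD_addProfile]
    omega
  refine ⟨hi, ?_, ?_, ?_, ?_, ?_⟩
  · simp only [hlen']; omega
  · simp only [hlen']; omega
  · simp only [List.getD_eq_getElem?_getD, List.getElem?_take]
    rw [if_pos (by omega), ← List.getD_eq_getElem?_getD, getD_addProfile, l2]
    exact h4
  · intro t ht hta
    simp only [hlen'] at hta ⊢
    simp only [List.getD_eq_getElem?_getD, List.getElem?_take]
    rw [if_pos (by omega), ← List.getD_eq_getElem?_getD]
    refine le_trans ?_ (key t ht (by omega))
    have := Nat.pow_le_pow_right (n := 2) (by norm_num) (show a + 1 - t ≤ p.length - 1 - t by omega)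
    omega
  · simp only [hlen']
    -- The new level rank is the component `a + 1`; a reserve of at least one remains there.
    refine le_trans ?_ (key (a + 1) (by omega) (by omega))
    have := Nat.one_le_two_pow (n := p.length - 1 - (a + 1))
    omega

/-! ## Counting lists -/

/-- The lists of length `j` whose components are bounded by `b`. -/
def boxLists (b : ℕ → ℕ) (j : ℕ) : Finset (List ℕ) :=
  (Fintype.piFinset fun t : Fin j => Finset.range (b t + 1)).image List.ofFn

theorem card_boxLists_le (b : ℕ → ℕ) (j : ℕ) :
    (boxLists b j).card ≤ ∏ t ∈ Finset.range j, (b t + 1) := by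
  refine Finset.card_image_le.trans ?_
  rw [Fintype.card_piFinset, Finset.prod_range]
  simp

theorem mem_boxLists {b : ℕ → ℕ} {j : ℕ} {l : List ℕ} (hl : l.length = j)
    (h : ∀ t < j, l.getD t 0 ≤ b t) : l ∈ boxLists b j := by
  subst hl
  refine Finset.mem_image.2 ⟨fun t => l.get t, ?_, List.ofFn_get l⟩
  simp only [Fintype.mem_piFinset, Finset.mem_range]
  intro t
  have := h t t.2
  simp at this ⊢
  omega

/-- The largest conceivable number of nodes of index `t` in a diagram of index `k`. -/
def levelBound (k t : ℕ) : ℕ := if t = 0 then 2 else 2 ^ (k - t)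

/-- A bound for the number of profiles. -/
def profileBound (k : ℕ) : ℕ := ∏ t ∈ Finset.range (k + 1), (levelBound k t + 1)

theorem prod_le_profileBound {j k : ℕ} (h : j ≤ k) :
    ∏ t ∈ Finset.range (j + 1), (levelBound k t + 1) ≤ profileBound k :=
  Finset.prod_le_prod_of_subset_of_one_le' (Finset.range_subset_range.2 (by omega))
    fun _ _ _ => Nat.le_add_left _ _

theorem profileBound_eq (k : ℕ) :
    profileBound k = 3 * ∏ a ∈ Finset.range k, (2 ^ a + 1) := by
  rw [profileBound, Finset.prod_range_succ', mul_comm, ← Finset.prod_range_reflect]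
  congr 1
  refine Finset.prod_congr rfl fun t ht => ?_
  rw [Finset.mem_range] at ht
  simp only [levelBound]
  rw [if_neg (by omega)]
  congr 2
  omega

theorem one_le_profileBound (k : ℕ) : 1 ≤ profileBound k :=
  Finset.one_le_prod' fun _ _ => Nat.le_add_left _ _

/-- The keys are distinct and lie in a box, so counting lattice points suffices. -/
theorem length_countDict_le {k n s : ℕ} {p : List ℕ} (hp : 1 ≤ p.length) (hk : p.length ≤ k) :
    (countDict n p s).length ≤ profileBound k := by
  have h1 : ((countDict n p s).map Prod.fst).Nodup := by
    rw [countDict_eq]; exact Dict.nodup_collect _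
  have h2 : ((countDict n p s).map Prod.fst).toFinset ⊆
      boxLists (levelBound k) (p.length + 1) := by
    intro l hl
    rw [List.mem_toFinset, List.mem_map] at hl
    obtain ⟨e, he, rfl⟩ := hl
    obtain ⟨g1, g2, g3⟩ := keyBound_countDict n p s hp e he
    refine mem_boxLists g1 fun t ht => ?_
    unfold levelBound
    split_ifs with h0
    · subst h0; omega
    · exact (g3 t (by omega) (by omega)).trans (Nat.pow_le_pow_right (by norm_num) (by omega))
  calc (countDict n p s).length = ((countDict n p s).map Prod.fst).toFinset.card := by
        rw [List.toFinset_card_of_nodup h1, List.length_map]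
    _ ≤ _ := Finset.card_le_card h2
    _ ≤ _ := card_boxLists_le _ _
    _ ≤ _ := prod_le_profileBound hk

theorem length_childDict_le {k i : ℕ} {p : List ℕ} {w : ℤ} (hp : 1 ≤ p.length)
    (hk : p.length ≤ k) : (childDict p.length i p w).length ≤ k * profileBound k := by
  unfold childDict
  split_ifs
  · exact Nat.mul_pos (by omega) (one_le_profileBound k)
  · rw [List.length_flatMap]
    refine (List.sum_le_card_nsmul _ (profileBound k) fun x hx => ?_).trans ?_
    · obtain ⟨a, -, rfl⟩ := List.mem_map.1 hx
      have := a.2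
      refine length_countDict_le ?_ ?_ <;> simp <;> omega
    · simp only [List.length_map, List.length_finRange, smul_eq_mul]
      exact Nat.mul_le_mul_right _ (by omega)

/-- The set of the arguments of calls. -/
def callSet (k N : ℕ) : Finset (ℕ × List ℕ × ℕ) :=
  (Finset.range (N + 1) ×ˢ ((Finset.Icc 1 k).biUnion fun j =>
    boxLists (levelBound k) j ×ˢ Finset.range (2 ^ (k - j))))

theorem ValidCall.mem_callSet {k N : ℕ} {c : ℕ × List ℕ × ℕ} (h : ValidCall k N c) :
    c ∈ callSet k N := by
  obtain ⟨h1, h2, h3, h4, h5, h6⟩ := h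
  simp only [callSet, Finset.mem_product, Finset.mem_range, Finset.mem_biUnion, Finset.mem_Icc]
  refine ⟨by omega, c.2.1.length, ⟨h2, h3⟩, mem_boxLists rfl fun t ht => ?_, by omega⟩
  unfold levelBound
  split_ifs with h0
  · subst h0; exact h4
  · exact (Nat.le_add_right _ _).trans (h5 t (by omega) ht)

/-- The level rank behaves like one further component of the profile, at level `j`, so that pairs of
profile and rank again number at most `profileBound k` for each length. -/
theorem card_callSet_le (k N : ℕ) :
    (callSet k N).card ≤ (N + 1) * (k * profileBound k) := by
  rw [callSet, Finset.card_product, Finset.card_range]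
  refine Nat.mul_le_mul_left _ (Finset.card_biUnion_le.trans ?_)
  refine (Finset.sum_le_card_nsmul _ _ (profileBound k) fun j hj => ?_).trans (by simp)
  rw [Finset.mem_Icc] at hj
  rw [Finset.card_product, Finset.card_range]
  calc _ ≤ (∏ t ∈ Finset.range j, (levelBound k t + 1)) * (levelBound k j + 1) := by
        refine Nat.mul_le_mul (card_boxLists_le _ _) ?_
        rw [levelBound, if_neg (by omega)]; omega
    _ = ∏ t ∈ Finset.range (j + 1), (levelBound k t + 1) := (Finset.prod_range_succ _ _).symm
    _ ≤ _ := prod_le_profileBound hj.2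

/-! ## The run -/

theorem spec_countM {k N X : ℕ} (hX : N * (2 + 2 * k + k * profileBound k *
      (3 * k + 5 + k * profileBound k * (2 * k + 8))) ≤ X) (n : ℕ) (p : List ℕ) (s : ℕ)
    (hc : ValidCall k N (n, p, s)) :
    Spec (callSet k N) X (p.length + 1) (countM n p s) (countDict n p s) 1 := by
  obtain ⟨j, hj⟩ : ∃ j, p.length = j := ⟨_, rfl⟩
  induction j using Nat.strong_induction_on generalizing n p s with
  | _ j ih =>
    have hp : 1 ≤ p.length := hc.2.1
    have hk : p.length ≤ k := hc.2.2.1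
    have hn : n ≤ N := hc.1
    have hrec : ∀ l, ChildBound p.length l → ∀ i ≤ N, ∀ a < p.length - 1,
        Spec (callSet k N) X p.length
          (countM i ((addProfile p l).take (a + 1)) ((addProfile p l).getD (a + 1) 0))
          (countDict i ((addProfile p l).take (a + 1)) ((addProfile p l).getD (a + 1) 0)) 1 := by
      intro l hl i hi a ha
      have hlen' : ((addProfile p l).take (a + 1)).length = a + 1 := by
        rw [List.length_take, length_addProfile]; omega
      exact (ih (a + 1) (by omega) _ _ _ (hc.child hl hi ha) hlen').mono (le_refl _) (by omega)
    have hadd : ∀ l, ChildBound p.length l → (addProfile p l).length = p.length := by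
      intro l hl
      have := hl.1
      rw [length_addProfile]; omega
    refine Spec.countM_of_body (A := k * profileBound k) (B := k * profileBound k)
      hc.mem_callSet hp ?_ ?_ ?_ ?_ ?_ ?_ ?_
    · intro i hi _ a ha
      have := hrec [] (childBound_nil _) i (by omega) a ha
      rwa [addProfile_nil] at this
    · intro i hi _ x hx a ha
      exact hrec x.1 (childBound_childDict _ _ _ x hx) _ (by omega) a ha
    · exact fun i hi => length_childDict_le hp hk
    · intro i hi x hx
      have e := hadd x.1 (childBound_childDict _ _ _ x hx)
      have := length_childDict_le (k := k) (i := n - 1 - i) (p := addProfile p x.1)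
        (w := -1 + (addProfile p x.1).sum) (by omega) (by omega)
      rwa [e] at this
    · exact fun i hi x hx => (childBound_childDict _ _ _ x hx).1
    · intro i hi x hx y hy
      have e := hadd x.1 (childBound_childDict _ _ _ x hx)
      rw [← e] at hy ⊢
      exact (childBound_childDict _ _ _ y hy).1
    · refine le_trans ?_ hX
      gcongr

theorem validCall_top {k N : ℕ} (hk : 1 ≤ k) :
    ValidCall k N (N, 2 :: List.replicate (k - 1) 0, 0) := by
  have hlen : (2 :: List.replicate (k - 1) 0).length = k := by simp; omega
  refine ⟨le_refl _, ?_, ?_, by simp, ?_, ?_⟩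
  · simp only [hlen]; omega
  · simp only [hlen]; omega
  · intro t ht htk
    simp only [hlen] at htk ⊢
    obtain ⟨u, rfl⟩ : ∃ u, t = u + 1 := ⟨t - 1, by omega⟩
    simp
  · simp only [hlen]; simp

/-- The potential of the empty table is zero, and the final one is at most `X` times the number of
admissible arguments. -/
theorem evalRun_spec (n k : ℕ) (hk : 1 ≤ k) :
    countValue n k = (countDict (n - 2) (2 :: List.replicate (k - 1) 0) 0).wsum (fun _ => 1) ∧
    countOps n k ≤ 2 + profileBound k + (n - 2) * (2 + 2 * k + k * profileBound k *
      (3 * k + 5 + k * profileBound k * (2 * k + 8))) *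
        ((n - 2 + 1) * (k * profileBound k)) := by
  set N := n - 2 with hN
  set p := 2 :: List.replicate (k - 1) 0 with hp
  have hlen : p.length = k := by simp [hp]; omega
  set X := N * (2 + 2 * k + k * profileBound k *
      (3 * k + 5 + k * profileBound k * (2 * k + 8))) with hX
  have hcall := spec_countM (le_of_eq hX.symm) N p 0 (validCall_top hk)
  have h : Spec (callSet k N) X (p.length + 1) (evalM n k)
      ((countDict N p 0).map Prod.snd).sum (1 + (1 + (countDict N p 0).length)) :=
    Spec.bind_le (Spec.of_tick 1) (Spec.bind_le hcall (Spec.bind_le (Spec.of_tick _)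
      (Spec.of_pure _) (le_refl _)) (le_refl _)) (le_refl _)
  obtain ⟨h1, -, h3, -⟩ := h { ops := 0, memo := fun _ => none } (fun _ _ h => by simp at h)
  constructor
  · unfold countValue evalRun
    rw [h1]
    simp [Dict.wsum]
  · unfold countOps evalRun
    have h5 := length_countDict_le (k := k) (n := N) (s := 0) (p := p) (by omega) (by omega)
    have h6 : CountState.stored (callSet k N) ((evalM n k).run { ops := 0, memo := fun _ => none }).2
        ≤ (N + 1) * (k * profileBound k) := (Finset.card_filter_le _ _).trans (card_callSet_le k N)
    have h7 := Nat.mul_le_mul_left X h6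
    simp only [zero_add] at h3
    omega

/-! ## The number of operations -/

/-- Each factor satisfies `2^a + 1 ≤ 2^a * exp (2^(-a))`, and the exponents `2^(-a)` sum to less
than 2. -/
theorem profileBound_le_rpow (k : ℕ) :
    (profileBound k : ℝ) ≤ 3 * Real.exp 2 * (2 : ℝ) ^ ((k : ℝ) * (k - 1) / 2) := by
  -- The exponent `2 - 2 * (1 / 2) ^ k` is the partial geometric sum, which makes the induction
  -- close.
  have h : ∀ k : ℕ, ∏ a ∈ Finset.range k, ((2 : ℝ) ^ a + 1) ≤
      Real.exp (2 - 2 * (1 / 2) ^ k) * (2 : ℝ) ^ ((k : ℝ) * (k - 1) / 2) := by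
    intro k
    induction k with
    | zero => simp
    | succ k ih =>
      rw [Finset.prod_range_succ]
      have h1 : (2 : ℝ) ^ k + 1 ≤ Real.exp ((1 / 2) ^ k) * 2 ^ (k : ℝ) := by
        have := Real.add_one_le_exp ((1 / 2 : ℝ) ^ k)
        have h2 : (1 / 2 : ℝ) ^ k * 2 ^ k = 1 := by rw [← mul_pow]; norm_num
        rw [Real.rpow_natCast]
        nlinarith [show (0 : ℝ) < 2 ^ k by positivity]
      calc _ ≤ (Real.exp (2 - 2 * (1 / 2) ^ k) * (2 : ℝ) ^ ((k : ℝ) * (k - 1) / 2)) *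
            (Real.exp ((1 / 2) ^ k) * 2 ^ (k : ℝ)) := by gcongr
        _ = (Real.exp (2 - 2 * (1 / 2) ^ k) * Real.exp ((1 / 2) ^ k)) *
            ((2 : ℝ) ^ ((k : ℝ) * (k - 1) / 2) * 2 ^ (k : ℝ)) := by ring
        _ = _ := by
          rw [← Real.exp_add, ← Real.rpow_add (by norm_num)]
          congr 2
          · rw [pow_succ]; ring
          · push_cast; ring
  rw [profileBound_eq]
  push_cast
  rw [mul_assoc]
  refine mul_le_mul_of_nonneg_left ((h k).trans ?_) (by norm_num)
  gcongr
  have : (0 : ℝ) < (1 / 2) ^ k := by positivity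
  linarith

theorem ops_bound_le {k Q N : ℕ} (hk : 1 ≤ k) (hQ : 1 ≤ Q) (hN : N + 1 ≤ 2 ^ k) :
    2 + Q + N * (2 + 2 * k + k * Q * (3 * k + 5 + k * Q * (2 * k + 8))) * ((N + 1) * (k * Q)) ≤
      25 * (k ^ 4 * 4 ^ k * Q ^ 3) := by
  obtain ⟨D, hD⟩ : ∃ D, D = k * Q := ⟨_, rfl⟩
  have hD1 : 1 ≤ D := hD ▸ Nat.mul_pos hk hQ
  have hQD : Q ≤ D := hD ▸ Nat.le_mul_of_pos_left _ hk
  rw [← hD]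
  have h1 : 3 * k + 5 + D * (2 * k + 8) ≤ 18 * (k * D) := by
    have : k ≤ k * D := Nat.le_mul_of_pos_right _ hD1
    have : D ≤ k * D := Nat.le_mul_of_pos_left _ hk
    nlinarith
  have h2 : 2 + 2 * k + D * (3 * k + 5 + D * (2 * k + 8)) ≤ 22 * (k * D ^ 2) := by
    have : k ≤ k * D ^ 2 := Nat.le_mul_of_pos_right _ (by positivity)
    have := Nat.mul_le_mul_left D h1
    nlinarith
  have h3 : N * (2 + 2 * k + D * (3 * k + 5 + D * (2 * k + 8))) * ((N + 1) * D) ≤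
      22 * (k * 4 ^ k * D ^ 3) := by
    calc _ ≤ 2 ^ k * (22 * (k * D ^ 2)) * (2 ^ k * D) := by gcongr; omega
      _ = 22 * (k * (2 ^ k * 2 ^ k) * D ^ 3) := by ring
      _ = _ := by rw [← mul_pow]; norm_num
  have h4 : D ≤ k * 4 ^ k * D ^ 3 := by
    calc D = 1 * 1 * D ^ 1 := by ring
      _ ≤ k * 4 ^ k * D ^ 3 := by
        gcongr
        · exact Nat.one_le_pow _ _ (by norm_num)
        · norm_num
  have h5 : k ^ 4 * 4 ^ k * Q ^ 3 = k * 4 ^ k * D ^ 3 := by rw [hD]; ring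
  rw [h5]
  omega

theorem exists_countOps_le : ∃ C : ℝ, ∀ n k : ℕ, 1 ≤ k → n ≤ 2 ^ k + 1 →
    (countOps n k : ℝ) ≤ C * ((1 / (k : ℝ)) * (2 : ℝ) ^ (3 * (k : ℝ) ^ 2 / 2 + (k : ℝ))) := by
  set E : ℝ := 3 * Real.exp 2 with hE
  -- `k ^ 5 * F` is the fifth term of the exponential series of `2 ^ (k / 2)`; the fifth power
  -- covers the `k ^ 4` of the count and the factor `1 / k` of the target.
  set F : ℝ := (Real.log 2 / 2) ^ 5 / (Nat.factorial 5 : ℝ) with hF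
  have hlog := Real.log_pos (show (1 : ℝ) < 2 by norm_num)
  have hF0 : 0 < F := by positivity
  refine ⟨25 * E ^ 3 / F, fun n k hk hn => ?_⟩
  have hk0 : (0 : ℝ) < k := by exact_mod_cast hk
  have hN : n - 2 + 1 ≤ 2 ^ k := by
    have := Nat.one_le_two_pow (n := k)
    omega
  have h1 : (countOps n k : ℝ) ≤ 25 * (k ^ 4 * 4 ^ k * profileBound k ^ 3) := by
    exact_mod_cast (evalRun_spec n k hk).2.trans (ops_bound_le hk (one_le_profileBound k) hN)
  have h2 := profileBound_le_rpow k
  rw [← hE] at h2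
  have h3 : (k : ℝ) ^ 5 * F ≤ 2 ^ ((k : ℝ) / 2) := by
    have := Real.pow_div_factorial_le_exp (x := k * (Real.log 2 / 2)) (by positivity) 5
    rw [Real.rpow_def_of_pos (by norm_num)]
    convert this using 1
    · rw [hF]; ring
    · congr 1; ring
  calc (countOps n k : ℝ) ≤ 25 * (k ^ 4 * 4 ^ k * profileBound k ^ 3) := h1
    _ ≤ 25 * (k ^ 4 * 4 ^ k * (E * (2 : ℝ) ^ ((k : ℝ) * (k - 1) / 2)) ^ 3) := by gcongr
    _ = 25 * E ^ 3 / F / k * ((k ^ 5 * F) * (4 ^ k * ((2 : ℝ) ^ ((k : ℝ) * (k - 1) / 2)) ^ 3)) := by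
      field_simp
    _ ≤ 25 * E ^ 3 / F / k * (2 ^ ((k : ℝ) / 2) *
        (4 ^ k * ((2 : ℝ) ^ ((k : ℝ) * (k - 1) / 2)) ^ 3)) := by gcongr
    _ = 25 * E ^ 3 / F / k * 2 ^ (3 * (k : ℝ) ^ 2 / 2 + (k : ℝ)) := by
      congr 1
      have e : (4 : ℝ) ^ k = 2 ^ (2 * (k : ℝ)) := by
        rw [Real.rpow_mul (by norm_num), Real.rpow_natCast]; norm_num
      rw [e, ← Real.rpow_natCast, ← Real.rpow_mul (by norm_num), ← Real.rpow_add (by norm_num),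
        ← Real.rpow_add (by norm_num)]
      congr 1
      push_cast
      ring
    _ = _ := by ring

/-! ## Codes of diagrams

A diagram is coded by the list of its decision nodes in the order in which a depth-first search
leaves them. A node is coded by its index and two references to its children; the references
`0` and `1` stand for the sinks, and `i + 2` for the node in position `i` of the list. -/

/-- A coded decision node: index, low child, and high child. -/
abbrev CNode := ℕ × ℕ × ℕ

/-- The index of the node with reference `c`. -/
def refIndex (L : List CNode) (c : ℕ) : ℕ := if c < 2 then 0 else (L.getD (c - 2) (0, 0, 0)).1

/-- The references to nodes of index less than `j`. -/
def poolRefs (j : ℕ) (L : List CNode) : List ℕ :=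
  (List.range (L.length + 2)).filter fun c => refIndex L c < j

/-- The lists obtained from the list `L` by a depth-first search from a new node of
index `j` that visits `m` new nodes. -/
def visits (j : ℕ) (L : List CNode) (m : ℕ) : List (List CNode) :=
  (List.range m).flatMap fun i =>
    (if i = 0 then (poolRefs j L).map fun c => (L, c) else
      (List.finRange (j - 1)).flatMap fun a =>
        (visits (a.val + 1) L i).map fun L' => (L', L'.length + 1)).flatMap fun x =>
    (if m - 1 - i = 0 then (poolRefs j x.1).map fun c => (x.1, c) else
      (List.finRange (j - 1)).flatMap fun a =>
        (visits (a.val + 1) x.1 (m - 1 - i)).map fun L' => (L', L'.length + 1)).flatMap fun y =>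
    if y.2 ≠ x.2 ∧ (j, x.2, y.2) ∉ y.1 then [y.1 ++ [(j, x.2, y.2)]] else []
termination_by j
decreasing_by
  · omega
  · omega

/-- The possible results of the visit of a child of a node of index `j`: the new list, and the
reference to the child. -/
def childVisits (j : ℕ) (L : List CNode) (i : ℕ) : List (List CNode × ℕ) :=
  if i = 0 then (poolRefs j L).map fun c => (L, c) else
    (List.finRange (j - 1)).flatMap fun a =>
      (visits (a.val + 1) L i).map fun L' => (L', L'.length + 1)

theorem visits_eq (j : ℕ) (L : List CNode) (m : ℕ) :
    visits j L m = (List.range m).flatMap fun i => (childVisits j L i).flatMap fun x =>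
      (childVisits j x.1 (m - 1 - i)).flatMap fun y =>
        if y.2 ≠ x.2 ∧ (j, x.2, y.2) ∉ y.1 then [y.1 ++ [(j, x.2, y.2)]] else [] := by
  rw [visits]; rfl

theorem mem_visits {j m : ℕ} {L L' : List CNode} :
    L' ∈ visits j L m ↔ ∃ i < m, ∃ x ∈ childVisits j L i, ∃ y ∈ childVisits j x.1 (m - 1 - i),
      y.2 ≠ x.2 ∧ (j, x.2, y.2) ∉ y.1 ∧ L' = y.1 ++ [(j, x.2, y.2)] := by
  rw [visits_eq]
  simp only [List.mem_flatMap, List.mem_range]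
  refine exists_congr fun i => and_congr_right fun _ => exists_congr fun x =>
    and_congr_right fun _ => exists_congr fun y => and_congr_right fun _ => ?_
  split_ifs with h
  · simp [h]
  · simp only [List.not_mem_nil, false_iff]
    tauto

theorem mem_childVisits {j i : ℕ} {L : List CNode} {x : List CNode × ℕ} :
    x ∈ childVisits j L i ↔ (i = 0 ∧ x.1 = L ∧ x.2 ∈ poolRefs j L) ∨
      (0 < i ∧ ∃ a, 1 ≤ a ∧ a < j ∧ x.1 ∈ visits a L i ∧ x.2 = x.1.length + 1) := by
  unfold childVisits
  split_ifs with h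
  · simp only [List.mem_map, h, true_and, lt_irrefl, false_and, or_false]
    constructor
    · rintro ⟨c, hc, rfl⟩; exact ⟨rfl, hc⟩
    · rintro ⟨h1, h2⟩; exact ⟨x.2, h2, by rw [← h1]⟩
  · simp only [h, false_and, false_or, List.mem_flatMap, List.mem_map, List.mem_finRange, true_and]
    constructor
    · rintro ⟨a, L', h1, rfl⟩
      exact ⟨by omega, a + 1, by omega, by omega, h1, rfl⟩
    · rintro ⟨-, a, h1, h2, h3, h4⟩
      refine ⟨⟨a - 1, by omega⟩, x.1, ?_, by rw [← h4]⟩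
      simpa [show a - 1 + 1 = a by omega] using h3

theorem refIndex_append {L : List CNode} (N : List CNode) {c : ℕ} (hc : c < L.length + 2) :
    refIndex (L ++ N) c = refIndex L c := by
  unfold refIndex
  split_ifs with h
  · rfl
  · rw [List.getD_append _ _ _ _ (by omega)]

theorem refIndex_concat (L : List CNode) (v : CNode) :
    refIndex (L ++ [v]) (L.length + 2) = v.1 := by
  simp [refIndex]

theorem mem_poolRefs {j : ℕ} {L : List CNode} {c : ℕ} :
    c ∈ poolRefs j L ↔ c < L.length + 2 ∧ refIndex L c < j := by
  simp [poolRefs]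

theorem nodup_poolRefs (j : ℕ) (L : List CNode) : (poolRefs j L).Nodup :=
  List.nodup_range.filter _

theorem poolRefs_subset_append {j : ℕ} {L : List CNode} (N : List CNode) {c : ℕ}
    (hc : c ∈ poolRefs j L) : c ∈ poolRefs j (L ++ N) := by
  rw [mem_poolRefs] at hc ⊢
  rw [refIndex_append N hc.1, List.length_append]
  exact ⟨by omega, hc.2⟩

theorem length_poolRefs {j : ℕ} (hj : 1 ≤ j) (L : List CNode) :
    (poolRefs j L).length = 2 + L.countP fun v => v.1 < j := by
  induction L using List.reverseRecOn with
  | nil =>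
    have : List.range 2 = [0, 1] := rfl
    simp [poolRefs, this, refIndex, show 0 < j from hj]
  | append_singleton L v ih =>
    have : poolRefs j (L ++ [v]) = poolRefs j L ++ (if v.1 < j then [L.length + 2] else []) := by
      unfold poolRefs
      rw [List.length_append, List.length_singleton,
        show L.length + 1 + 2 = (L.length + 2) + 1 by ring, List.range_succ, List.filter_append]
      congr 1
      · refine List.filter_congr fun c hc => ?_
        rw [refIndex_append [v] (List.mem_range.1 hc)]
      · simp only [List.filter_singleton, refIndex_concat]
        simp
    rw [this, List.length_append, ih, List.countP_append]
    split_ifs with h <;> simp [h]; omega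

/-! ## Profiles -/

/-- The number of nodes of index `t`, sinks included. -/
def levelCount (L : List CNode) (t : ℕ) : ℕ :=
  (if t = 0 then 2 else 0) + L.countP fun v => v.1 = t

/-- The profile of a pool below the index `j`. -/
def poolProfile (j : ℕ) (L : List CNode) : List ℕ := (List.range j).map (levelCount L)

@[simp] theorem length_poolProfile (j : ℕ) (L : List CNode) : (poolProfile j L).length = j := by
  simp [poolProfile]

theorem getD_poolProfile (j : ℕ) (L : List CNode) (t : ℕ) :
    (poolProfile j L).getD t 0 = if t < j then levelCount L t else 0 := by
  split_ifs with h
  · simp [poolProfile, h]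
  · rw [List.getD_eq_default _ _ (by simpa using h)]

theorem sum_countP_eq (L : List CNode) (j : ℕ) :
    ((List.range j).map fun t => L.countP fun v => v.1 = t).sum = L.countP fun v => v.1 < j := by
  induction j with
  | zero => simp
  | succ j ih =>
    rw [List.range_succ, List.map_append, List.sum_append, ih]
    simp only [List.map_cons, List.map_nil, List.sum_cons, List.sum_nil, add_zero]
    clear ih
    induction L with
    | nil => simp
    | cons v L ihL =>
      simp only [List.countP_cons, decide_eq_true_eq]
      split_ifs <;> omega

theorem sum_poolProfile {j : ℕ} (hj : 1 ≤ j) (L : List CNode) :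
    (poolProfile j L).sum = (poolRefs j L).length := by
  rw [length_poolRefs hj, ← sum_countP_eq]
  obtain ⟨j, rfl⟩ : ∃ i, j = i + 1 := ⟨j - 1, by omega⟩
  unfold poolProfile levelCount
  rw [List.sum_map_add]
  congr 1
  simp [List.range_succ_eq_map, Function.comp_def]

/-- The key of a list of new nodes in a dictionary. -/
def newKey (N : List CNode) : List ℕ :=
  match N.getLast? with
  | none => []
  | some v => (List.range (v.1 + 1)).map fun t => N.countP fun u => u.1 = t

theorem newKey_concat (N : List CNode) (v : CNode) : newKey (N ++ [v]) =
    (List.range (v.1 + 1)).map fun t => (N ++ [v]).countP fun u => u.1 = t := by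
  simp [newKey]

theorem length_newKey_concat (N : List CNode) (v : CNode) :
    (newKey (N ++ [v])).length = v.1 + 1 := by
  simp [newKey_concat]

theorem getD_newKey_concat {N : List CNode} {v : CNode} (h : ∀ u ∈ N, u.1 < v.1) (t : ℕ) :
    (newKey (N ++ [v])).getD t 0 = (N ++ [v]).countP fun u => u.1 = t := by
  by_cases ht : t < v.1 + 1
  · rw [newKey_concat]
    rw [List.getD_eq_getElem _ _ (by simpa using ht)]
    simp
  · rw [List.getD_eq_default _ _ (by rw [length_newKey_concat]; omega), eq_comm,
      List.countP_eq_zero]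
    intro u hu
    rcases List.mem_append.1 hu with hu | hu
    · have := h u hu; simp; omega
    · rw [List.mem_singleton] at hu; subst hu; simp; omega

/-- The new nodes visited from a child of a node of index `j`. -/
def ChildNodes (j : ℕ) (N : List CNode) : Prop :=
  (∀ u ∈ N, u.1 < j) ∧ (newKey N).length ≤ j ∧
    ∀ t, (newKey N).getD t 0 = N.countP fun u => u.1 = t

theorem childNodes_nil (j : ℕ) : ChildNodes j [] := by simp [ChildNodes, newKey]

theorem childNodes_concat {j : ℕ} {N : List CNode} {v : CNode} (h : ∀ u ∈ N, u.1 < v.1)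
    (hv : v.1 < j) : ChildNodes j (N ++ [v]) := by
  refine ⟨fun u hu => ?_, by rw [length_newKey_concat]; omega, getD_newKey_concat h⟩
  rcases List.mem_append.1 hu with hu | hu
  · exact (h u hu).trans hv
  · rw [List.mem_singleton] at hu; subst hu; exact hv

theorem ext_getD {l l' : List ℕ} (h : l.length = l'.length)
    (h' : ∀ t, l.getD t 0 = l'.getD t 0) : l = l' := by
  refine List.ext_getElem h fun t h1 h2 => ?_
  have := h' t
  rwa [List.getD_eq_getElem _ _ h1, List.getD_eq_getElem _ _ h2] at this

/-- This is the reason why the algorithm can update the pool by adding a key: levels of the pool and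
of the appended nodes add up. -/
theorem addProfile_newKey {j : ℕ} {N : List CNode} (L : List CNode) (h : ChildNodes j N) :
    addProfile (poolProfile j L) (newKey N) = poolProfile j (L ++ N) := by
  obtain ⟨h1, h2, h3⟩ := h
  refine ext_getD (by rw [length_addProfile]; simpa using h2) fun t => ?_
  rw [getD_addProfile, getD_poolProfile, getD_poolProfile, h3]
  split_ifs with ht
  · simp [levelCount, add_assoc]
  · rw [zero_add, List.countP_eq_zero]
    intro u hu
    have := h1 u hu
    simp; omega

theorem newKey_node {j : ℕ} {M N : List CNode} (c c' : ℕ) (hM : ChildNodes j M)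
    (hN : ChildNodes j N) : newKey (M ++ N ++ [(j, c, c')]) =
      addProfile (addProfile (newKey M) (newKey N)) (List.replicate j 0 ++ [1]) := by
  obtain ⟨m1, m2, m3⟩ := hM
  obtain ⟨n1, n2, n3⟩ := hN
  refine ext_getD ?_ fun t => ?_
  · rw [length_newKey_concat]
    simp only [length_addProfile, List.length_append, List.length_replicate, List.length_cons,
      List.length_nil]
    omega
  · rw [getD_newKey_concat, getD_addProfile, getD_addProfile, m3, n3, getD_unit,
      List.countP_append, List.countP_append]
    · simp [List.countP_cons, eq_comm]
    · intro u hu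
      rcases List.mem_append.1 hu with hu | hu
      · exact m1 u hu
      · exact n1 u hu

/-! ## The shape of a visit -/

/-- The shape of smaller visits is a hypothesis here, so that the lemma can serve inside the
induction that establishes it. -/
theorem childVisits_shape_of {j : ℕ} (ih : ∀ a < j, ∀ L m L', L' ∈ visits a L m → ∃ N c c',
      L' = L ++ N ++ [(a, c, c')] ∧ N.length + 1 = m ∧ ∀ v ∈ N, v.1 < a)
    {L : List CNode} {i : ℕ} {x : List CNode × ℕ} (hx : x ∈ childVisits j L i) :
    ∃ N, x.1 = L ++ N ∧ N.length = i ∧ ChildNodes j N ∧ x.2 ∈ poolRefs j x.1 ∧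
      (0 < i → x.2 = x.1.length + 1) := by
  rcases mem_childVisits.1 hx with ⟨rfl, h1, h2⟩ | ⟨hi, a, h1, h2, h3, h4⟩
  · exact ⟨[], by simp [h1], rfl, childNodes_nil j, h1.symm ▸ h2, by simp⟩
  · obtain ⟨N, c, c', e, hl, hN⟩ := ih a h2 _ _ _ h3
    refine ⟨N ++ [(a, c, c')], by rw [e, List.append_assoc], by simpa using hl,
      childNodes_concat hN h2, ?_, fun _ => h4⟩
    rw [mem_poolRefs, h4, e, List.length_append, List.length_singleton, refIndex_concat]
    exact ⟨by omega, h2⟩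

theorem visits_shape {j m : ℕ} {L L' : List CNode} (h : L' ∈ visits j L m) : ∃ N c c',
    L' = L ++ N ++ [(j, c, c')] ∧ N.length + 1 = m ∧ ∀ v ∈ N, v.1 < j := by
  induction j using Nat.strong_induction_on generalizing m L L' with
  | _ j ih =>
    have ih' : ∀ a < j, ∀ L m L', L' ∈ visits a L m → ∃ N c c',
      L' = L ++ N ++ [(a, c, c')] ∧ N.length + 1 = m ∧ ∀ v ∈ N, v.1 < a :=
      fun a ha L m L' h => ih a ha h
    obtain ⟨i, hi, x, hx, y, hy, -, -, rfl⟩ := mem_visits.1 h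
    obtain ⟨M, e1, l1, m1, -⟩ := childVisits_shape_of ih' hx
    obtain ⟨N, e2, l2, n1, -⟩ := childVisits_shape_of ih' hy
    refine ⟨M ++ N, x.2, y.2, by rw [e2, e1]; simp, by rw [List.length_append]; omega, ?_⟩
    intro v hv
    rcases List.mem_append.1 hv with hv | hv
    · exact m1.1 v hv
    · exact n1.1 v hv

theorem childVisits_shape {j i : ℕ} {L : List CNode} {x : List CNode × ℕ}
    (hx : x ∈ childVisits j L i) :
    ∃ N, x.1 = L ++ N ∧ N.length = i ∧ ChildNodes j N ∧ x.2 ∈ poolRefs j x.1 ∧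
      (0 < i → x.2 = x.1.length + 1) :=
  childVisits_shape_of (fun _ _ _ _ _ h => visits_shape h) hx

/-- Codes of sets of decision nodes that are closed under taking children. -/
inductive IsPool : List CNode → Prop
  | nil : IsPool []
  | concat {L : List CNode} {j c c' : ℕ} (hL : IsPool L) (hc : c ∈ poolRefs j L)
      (hc' : c' ∈ poolRefs j L) (hne : c' ≠ c) (hnew : (j, c, c') ∉ L) :
      IsPool (L ++ [(j, c, c')])

theorem IsPool.nodup {L : List CNode} (h : IsPool L) : L.Nodup := by
  induction h with
  | nil => exact List.nodup_nil
  | concat hL hc hc' hne hnew ih => simpa using (List.nodup_concat _ _).2 ⟨hnew, ih⟩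

theorem IsPool.refs {L : List CNode} (h : IsPool L) {v : CNode} (hv : v ∈ L) :
    v.2.1 ∈ poolRefs v.1 L ∧ v.2.2 ∈ poolRefs v.1 L ∧ v.2.2 ≠ v.2.1 := by
  induction h with
  | nil => simp at hv
  | concat hL hc hc' hne hnew ih =>
    rcases List.mem_append.1 hv with hv | hv
    · obtain ⟨h1, h2, h3⟩ := ih hv
      exact ⟨poolRefs_subset_append _ h1, poolRefs_subset_append _ h2, h3⟩
    · rw [List.mem_singleton] at hv
      subst hv
      exact ⟨poolRefs_subset_append _ hc, poolRefs_subset_append _ hc', hne⟩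

/-- The two tests made when a node is appended are those of `IsPool.concat`; references into an
earlier pool survive appending. -/
theorem IsPool.visits {j m : ℕ} {L L' : List CNode} (hL : IsPool L) (h : L' ∈ visits j L m) :
    IsPool L' := by
  induction j using Nat.strong_induction_on generalizing m L L' with
  | _ j ih =>
    have hc : ∀ {L i x}, IsPool L → x ∈ childVisits j L i → IsPool x.1 := by
      intro L i x hL hx
      rcases mem_childVisits.1 hx with ⟨-, h1, -⟩ | ⟨-, a, -, h2, h3, -⟩
      · rwa [h1]
      · exact ih a h2 hL h3
    obtain ⟨i, hi, x, hx, y, hy, h1, h2, rfl⟩ := mem_visits.1 h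
    obtain ⟨N, e2, -, -, hy2, -⟩ := childVisits_shape hy
    obtain ⟨-, -, -, -, hx2, -⟩ := childVisits_shape hx
    exact IsPool.concat (hc (hc hL hx) hy) (e2 ▸ poolRefs_subset_append N hx2) hy2 h1 h2

theorem IsPool.childVisits {j i : ℕ} {L : List CNode} {x : List CNode × ℕ} (hL : IsPool L)
    (hx : x ∈ childVisits j L i) : IsPool x.1 := by
  rcases mem_childVisits.1 hx with ⟨-, h1, -⟩ | ⟨-, a, -, h2, h3, -⟩
  · rwa [h1]
  · exact hL.visits h3

/-! ## The dictionaries count visits -/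

theorem sum_map_flatMap {α β : Type*} (l : List α) (f : α → List β) (g : β → ℤ) :
    ((l.flatMap f).map g).sum = (l.map fun a => ((f a).map g).sum).sum := by
  induction l with
  | nil => simp
  | cons a l ih => simp [ih]

theorem sum_map_congr {α : Type*} {l : List α} {f g : α → ℤ} (h : ∀ a ∈ l, f a = g a) :
    (l.map f).sum = (l.map g).sum := by
  rw [List.map_congr_left h]

theorem sum_map_sub_int {α : Type*} (l : List α) (f g : α → ℤ) :
    (l.map fun a => f a - g a).sum = (l.map f).sum - (l.map g).sum := by
  induction l with
  | nil => simp
  | cons a l ih => simp only [List.map_cons, List.sum_cons, ih]; ring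

theorem sum_addProfile : ∀ p q : List ℕ, (addProfile p q).sum = p.sum + q.sum
  | [], q => by simp [addProfile]
  | a :: p, [] => by simp [addProfile]
  | a :: p, b :: q => by simp only [addProfile, List.sum_cons, sum_addProfile p q]; ring

theorem pos_of_mem_countDict {n s : ℕ} {p : List ℕ} : ∀ e ∈ countDict n p s, 0 < e.2 := by
  rw [countDict_eq]
  refine Dict.collect_induction (P := fun e => 0 < e.2) (fun e he => ?_)
    fun t x w h1 h2 => add_pos h1 h2
  simp only [List.mem_flatMap] at he
  obtain ⟨i, -, x, -, y, -, he⟩ := he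
  exact (mem_nodeEntry he).2

theorem nonneg_of_mem_childDict {j i : ℕ} {p : List ℕ} {w : ℤ} (hw : 0 ≤ w) :
    ∀ e ∈ childDict j i p w, 0 ≤ e.2 := by
  intro e he
  rcases mem_childDict he with rfl | ⟨a, -, h⟩
  · exact hw
  · exact (pos_of_mem_countDict e h).le

/-- The number of pairs of children that are taken by the nodes of index `j` in the pool. -/
theorem IsPool.sum_taken {L : List CNode} (hL : IsPool L) (j : ℕ) :
    ((poolRefs j L).map fun c => ((poolRefs j L).map fun c' =>
      if (j, c, c') ∈ L then (1 : ℤ) else 0).sum).sum = L.countP fun v => v.1 = j := by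
  have hR := nodup_poolRefs j L
  have e1 : ∀ f : ℕ → ℤ, ((poolRefs j L).map f).sum = ∑ c ∈ (poolRefs j L).toFinset, f c :=
    fun f => (List.sum_toFinset f hR).symm
  simp only [e1]
  rw [← Finset.sum_product', Finset.sum_boole, List.countP_eq_length_filter,
    ← List.toFinset_card_of_nodup (hL.nodup.filter _)]
  congr 1
  -- A node of index `j` corresponds to its pair of children, and closedness of the pool puts that
  -- pair into the range of summation.
  refine Finset.card_nbij' (fun q => (j, q.1, q.2)) (fun v => v.2) ?_ ?_ ?_ ?_
  · intro q hq
    simp at hq ⊢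
    exact hq.2
  · rintro ⟨i, c, c'⟩ hv
    simp only [List.coe_toFinset, Set.mem_ofPred_eq, List.mem_filter, decide_eq_true_eq] at hv
    obtain ⟨hv, rfl⟩ := hv
    obtain ⟨h1, h2, -⟩ := hL.refs hv
    simp [h1, h2, hv]
  · intro q _; rfl
  · rintro ⟨i, c, c'⟩ hv
    simp only [List.coe_toFinset, Set.mem_ofPred_eq, List.mem_filter, decide_eq_true_eq] at hv
    obtain ⟨hv, rfl⟩ := hv
    rfl

theorem sum_ite_ne {l : List ℕ} (hl : l.Nodup) {x : ℕ} (hx : x ∈ l) :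
    (l.map fun c => if c ≠ x then (1 : ℤ) else 0).sum = -1 + l.length := by
  have h : ∀ c, (if c ≠ x then (1 : ℤ) else 0) = 1 - if c = x then 1 else 0 := by
    intro c; split_ifs <;> simp_all
  simp only [h]
  rw [List.sum_toFinset _ hl |>.symm, Finset.sum_sub_distrib, Finset.sum_ite_eq',
    if_pos (by simpa using hx), Finset.sum_const, List.toFinset_card_of_nodup hl]
  simp; ring

/-- The number of nodes of index `j` that can be added to a pool. -/
theorem IsPool.sum_free {L : List CNode} (hL : IsPool L) (j : ℕ) :
    ((poolRefs j L).map fun c => ((poolRefs j L).map fun c' =>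
      if c' ≠ c ∧ (j, c, c') ∉ L then (1 : ℤ) else 0).sum).sum =
      (poolRefs j L).length * (-1 + (poolRefs j L).length) - L.countP fun v => v.1 = j := by
  rw [← hL.sum_taken]
  -- Nodes in the pool have distinct children, so the taken pairs are among the pairs with `c' ≠ c`
  -- and the subtraction is exact.
  have h : ∀ c c' : ℕ, (if c' ≠ c ∧ (j, c, c') ∉ L then (1 : ℤ) else 0) =
      (if c' ≠ c then 1 else 0) - if (j, c, c') ∈ L then 1 else 0 := by
    intro c c'
    by_cases hm : (j, c, c') ∈ L
    · have := (hL.refs hm).2.2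
      simp_all
    · simp [hm]
  simp only [h, sum_map_sub_int]
  congr 1
  rw [sum_map_congr fun c hc => sum_ite_ne (nodup_poolRefs j L) hc]
  simp

/-- The test `w > 0` discards only zero weights once negative ones are excluded. -/
theorem sum_nodeEntry {n j s : ℕ} {x y : List ℕ × ℤ} (g : List ℕ → ℤ)
    (h : 0 ≤ if n = 1 then x.2 * y.2 - (s : ℤ) else x.2 * y.2) :
    ((nodeEntry n j s x y).map fun e => e.2 * g e.1).sum =
      (if n = 1 then x.2 * y.2 - (s : ℤ) else x.2 * y.2) *
        g (addProfile (addProfile x.1 y.1) (List.replicate j 0 ++ [1])) := by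
  have e : nodeEntry n j s x y = if 0 < (if n = 1 then x.2 * y.2 - (s : ℤ) else x.2 * y.2) then
    [(addProfile (addProfile x.1 y.1) (List.replicate j 0 ++ [1]),
      if n = 1 then x.2 * y.2 - (s : ℤ) else x.2 * y.2)] else [] := rfl
  rw [e]
  by_cases h0 : 0 < (if n = 1 then x.2 * y.2 - (s : ℤ) else x.2 * y.2)
  · rw [if_pos h0]; simp
  · rw [if_neg h0, le_antisymm (not_lt.1 h0) h]; simp

/-- The dictionary of `count` gives the distribution of the profiles of the visits. -/
def Counts (j : ℕ) : Prop :=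
  ∀ L, IsPool L → ∀ m g, (countDict m (poolProfile j L) (levelCount L j)).wsum g =
    ((visits j L m).map fun L' => g (newKey (L'.drop L.length))).sum

theorem take_poolProfile {a j : ℕ} (h : a ≤ j) (L : List CNode) :
    (poolProfile j L).take a = poolProfile a L := by
  rw [poolProfile, ← List.map_take, List.take_range, min_eq_left h]; rfl

theorem wsum_childDict {j : ℕ} (ih : ∀ a, 1 ≤ a → a < j → Counts a) {L : List CNode}
    (hL : IsPool L) {i : ℕ} (hi : 0 < i) (w : ℤ) (G : List ℕ → ℤ) :
    (childDict j i (poolProfile j L) w).wsum G =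
      ((childVisits j L i).map fun x => G (newKey (x.1.drop L.length))).sum := by
  have h0 : i ≠ 0 := by omega
  unfold childDict childVisits Dict.wsum
  rw [if_neg h0, if_neg h0, sum_map_flatMap, sum_map_flatMap]
  refine sum_map_congr fun a _ => ?_
  have ha := a.2
  have := ih (a + 1) (by omega) (by omega) L hL i G
  unfold Dict.wsum at this
  rw [take_poolProfile (by omega), getD_poolProfile, if_pos (by omega), this, List.map_map]
  rfl

theorem wsum_childDict_zero (j : ℕ) (p : List ℕ) (w : ℤ) (G : List ℕ → ℤ) :
    (childDict j 0 p w).wsum G = w * G [] := by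
  simp [childDict, Dict.wsum]

theorem sum_childVisits_zero (j : ℕ) (L : List CNode) (G : List CNode × ℕ → ℤ) :
    ((childVisits j L 0).map G).sum = ((poolRefs j L).map fun c => G (L, c)).sum := by
  simp [childVisits, Function.comp_def]

theorem wsum_childDict_left {j : ℕ} (hj : 1 ≤ j) (ih : ∀ a, 1 ≤ a → a < j → Counts a)
    {L : List CNode} (hL : IsPool L) (i : ℕ) (G : List ℕ → ℤ) :
    (childDict j i (poolProfile j L) (poolProfile j L).sum).wsum G =
      ((childVisits j L i).map fun x => G (newKey (x.1.drop L.length))).sum := by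
  rcases Nat.eq_zero_or_pos i with rfl | hi
  · rw [wsum_childDict_zero, sum_childVisits_zero, sum_poolProfile hj]
    simp [newKey]
  · exact wsum_childDict ih hL hi _ G

/-- If the subtree has more than one node, then the root differs from the nodes in the pool. -/
theorem IsPool.concat_notMem {L M N : List CNode} {j c c' : ℕ} (hL : IsPool L)
    (hM : ∀ v ∈ M, v.1 < j) (hN : ∀ v ∈ N, v.1 < j)
    (h : L.length + 2 ≤ c ∨ L.length + 2 ≤ c') : (j, c, c') ∉ L ++ M ++ N := by
  intro hm
  rw [List.mem_append, List.mem_append] at hm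
  rcases hm with (hm | hm) | hm
  · obtain ⟨h1, h2, -⟩ := hL.refs hm
    have := (mem_poolRefs.1 h1).1
    have := (mem_poolRefs.1 h2).1
    dsimp only at *
    omega
  · exact lt_irrefl _ (hM _ hm)
  · exact lt_irrefl _ (hN _ hm)

/-- For `m ≠ 1` at least one child is new, so duplication is impossible and only distinctness of the
children remains. It costs one target for a pointer into the pool, whence `-1 + sum`, and nothing
for a new right child, whose reference exceeds all earlier ones. -/
theorem wsum_childDict_right {j m i : ℕ} (hj : 1 ≤ j) (ih : ∀ a, 1 ≤ a → a < j → Counts a)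
    {L : List CNode} (hL : IsPool L) (hi : i < m) (hm : m ≠ 1) (g : List ℕ → ℤ)
    {x : List CNode × ℕ} (hx : x ∈ childVisits j L i) :
    (childDict j (m - 1 - i) (poolProfile j x.1) (-1 + (poolProfile j x.1).sum)).wsum
      (fun r => g (addProfile (addProfile (newKey (x.1.drop L.length)) r)
        (List.replicate j 0 ++ [1]))) =
      ((childVisits j x.1 (m - 1 - i)).map fun y =>
        if y.2 ≠ x.2 ∧ (j, x.2, y.2) ∉ y.1 then
          g (newKey ((y.1 ++ [(j, x.2, y.2)]).drop L.length)) else 0).sum := by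
  obtain ⟨M, e1, l1, m1, mx, nx⟩ := childVisits_shape hx
  have hkey : ∀ y ∈ childVisits j x.1 (m - 1 - i),
      newKey ((y.1 ++ [(j, x.2, y.2)]).drop L.length) =
        addProfile (addProfile (newKey (x.1.drop L.length)) (newKey (y.1.drop x.1.length)))
        (List.replicate j 0 ++ [1]) := by
    intro y hy
    obtain ⟨N, e2, l2, n1, -⟩ := childVisits_shape hy
    rw [e2, List.drop_left, e1, List.drop_left, ← newKey_node x.2 y.2 m1 n1]
    congr 1
    simp [List.append_assoc]
  have hnotin : ∀ y ∈ childVisits j x.1 (m - 1 - i), (j, x.2, y.2) ∉ y.1 := by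
    intro y hy
    obtain ⟨N, e2, l2, n1, -, ny⟩ := childVisits_shape hy
    rw [e2, e1]
    refine hL.concat_notMem m1.1 n1.1 ?_
    have hx1 : x.1.length = L.length + i := by rw [e1, List.length_append, l1]
    have hy1 : y.1.length = x.1.length + (m - 1 - i) := by rw [e2, List.length_append, l2]
    by_cases h0 : 0 < i
    · have := nx h0; omega
    · have := ny (by omega); omega
  rcases Nat.eq_zero_or_pos (m - 1 - i) with h0 | h0
  · rw [h0] at hkey hnotin ⊢
    rw [wsum_childDict_zero, sum_childVisits_zero, sum_poolProfile hj,
      ← sum_ite_ne (nodup_poolRefs j x.1) mx, ← List.sum_map_mul_right]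
    refine sum_map_congr fun c hc => ?_
    have hy : (x.1, c) ∈ childVisits j x.1 0 := mem_childVisits.2 (Or.inl ⟨rfl, rfl, hc⟩)
    have h1 := hkey _ hy
    have h2 := hnotin _ hy
    dsimp only at h1 h2 ⊢
    rw [h1, List.drop_length]
    simp [h2, newKey]
  · rw [wsum_childDict ih (hL.childVisits hx) h0]
    refine sum_map_congr fun y hy => ?_
    obtain ⟨N, e2, l2, -, -, ny⟩ := childVisits_shape hy
    have hne : y.2 ≠ x.2 := by
      have := ny h0
      have := (mem_poolRefs.1 mx).1
      have : y.1.length = x.1.length + (m - 1 - i) := by rw [e2, List.length_append, l2]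
      omega
    rw [if_pos ⟨hne, hnotin y hy⟩, hkey y hy]

/-- The sum over right children depends on the left visit only through its key. Hence it is a test
function for the left dictionary, to which the induction hypothesis applies; this is why `Counts`
quantifies over all `g`. -/
theorem counts (j : ℕ) (hj : 1 ≤ j) : Counts j := by
  induction j using Nat.strong_induction_on with
  | _ j ih =>
    have ih' : ∀ a, 1 ≤ a → a < j → Counts a := fun a h1 h2 => ih a h2 h1
    intro L hL m g
    have hvis : ((visits j L m).map fun L' => g (newKey (L'.drop L.length))).sum =
        ((List.range m).map fun i => ((childVisits j L i).map fun x =>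
          ((childVisits j x.1 (m - 1 - i)).map fun y =>
            if y.2 ≠ x.2 ∧ (j, x.2, y.2) ∉ y.1 then
              g (newKey ((y.1 ++ [(j, x.2, y.2)]).drop L.length)) else 0).sum).sum).sum := by
      rw [visits_eq, sum_map_flatMap]
      refine sum_map_congr fun i _ => ?_
      rw [sum_map_flatMap]
      refine sum_map_congr fun x _ => ?_
      rw [sum_map_flatMap]
      refine sum_map_congr fun y _ => ?_
      split_ifs <;> simp
    rw [hvis, countDict_eq, Dict.wsum_collect, sum_map_flatMap, length_poolProfile]
    refine sum_map_congr fun i hi => ?_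
    rw [List.mem_range] at hi
    rw [sum_map_flatMap]
    -- If `m = 1`, both children lie in the pool; this is the only case in which `s` pairs have to
    -- be removed.
    by_cases hm : m = 1
    · subst hm
      obtain rfl : i = 0 := by omega
      have hfree := hL.sum_free j
      have hs : levelCount L j = L.countP fun v => v.1 = j := by
        rw [levelCount, if_neg (by omega), zero_add]
      rw [← hs, ← sum_poolProfile hj] at hfree
      rw [sum_childVisits_zero]
      simp only [sum_childVisits_zero, Nat.sub_self]
      simp only [childDict, if_true, List.map_cons, List.map_nil, List.sum_cons, List.sum_nil,
        add_zero, List.flatMap_cons, List.flatMap_nil, List.append_nil, addProfile_nil]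
      rw [sum_nodeEntry]
      · simp only [if_true]
        rw [← hfree, ← List.sum_map_mul_right]
        refine sum_map_congr fun c _ => ?_
        rw [← List.sum_map_mul_right]
        refine sum_map_congr fun c' _ => ?_
        have := newKey_node c c' (childNodes_nil j) (childNodes_nil j)
        split_ifs
        · rw [one_mul, List.drop_left]
          exact congrArg g this.symm
        · simp
      · simp only [if_true]
        rw [← hfree]
        refine List.sum_nonneg fun z hz => ?_
        obtain ⟨c, -, rfl⟩ := List.mem_map.1 hz
        refine List.sum_nonneg fun z hz => ?_
        obtain ⟨c', -, rfl⟩ := List.mem_map.1 hz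
        split_ifs <;> simp
    -- The two sinks are always available, so no pointer weight is negative and no contribution is
    -- lost.
    · have hsum : ∀ l, 0 ≤ -1 + ((addProfile (poolProfile j L) l).sum : ℤ) := by
        intro l
        have : 2 ≤ (addProfile (poolProfile j L) l).sum := by
          rw [sum_addProfile, sum_poolProfile hj, length_poolRefs hj]
          omega
        omega
      have hleft : ∀ x ∈ childDict j i (poolProfile j L) (poolProfile j L).sum, 0 ≤ x.2 :=
        nonneg_of_mem_childDict (by positivity)
      have hprof : ∀ x ∈ childVisits j L i, poolProfile j x.1 =
          addProfile (poolProfile j L) (newKey (x.1.drop L.length)) := by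
        intro x hx
        obtain ⟨N, e, -, hN, -⟩ := childVisits_shape hx
        rw [e, List.drop_left, addProfile_newKey L hN]
      set F : List ℕ → ℤ := fun l => (childDict j (m - 1 - i)
          (addProfile (poolProfile j L) l) (-1 + (addProfile (poolProfile j L) l).sum)).wsum
          fun r => g (addProfile (addProfile l r) (List.replicate j 0 ++ [1])) with hF
      have hright : ∀ x ∈ childVisits j L i, ((childVisits j x.1 (m - 1 - i)).map fun y =>
          if y.2 ≠ x.2 ∧ (j, x.2, y.2) ∉ y.1 then
            g (newKey ((y.1 ++ [(j, x.2, y.2)]).drop L.length)) else 0).sum =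
            F (newKey (x.1.drop L.length)) := by
        intro x hx
        rw [← wsum_childDict_right hj ih' hL hi hm g hx, hprof x hx]
      rw [sum_map_congr hright, ← wsum_childDict_left hj ih' hL i F, Dict.wsum]
      refine sum_map_congr fun x hx => ?_
      rw [sum_map_flatMap, hF]
      simp only [Dict.wsum]
      rw [← List.sum_map_mul_left]
      refine sum_map_congr fun y hy => ?_
      have h0 : 0 ≤ x.2 * y.2 :=
        mul_nonneg (hleft x hx) (nonneg_of_mem_childDict (hsum _) y hy)
      rw [sum_nodeEntry _ (by rwa [if_neg hm]), if_neg hm, mul_assoc]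

theorem wsum_countDict_eq_length_visits {k : ℕ} (hk : 1 ≤ k) (m : ℕ) :
    (countDict m (2 :: List.replicate (k - 1) 0) 0).wsum (fun _ => 1) =
      (visits k [] m).length := by
  have h := counts k hk [] IsPool.nil m fun _ => 1
  have e : poolProfile k [] = 2 :: List.replicate (k - 1) 0 := by
    obtain ⟨k, rfl⟩ : ∃ i, k = i + 1 := ⟨k - 1, by omega⟩
    rw [poolProfile, List.range_succ_eq_map]
    simp [levelCount, List.eq_replicate_iff]
  have e' : levelCount [] k = 0 := by simp [levelCount]; omega
  rw [e, e'] at h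
  simpa using h

/-! ## The visits are listed without repetition -/

theorem nodup_flatMap_of {α β : Type*} {l : List α} {f : α → List β} (hl : l.Nodup)
    (h1 : ∀ a ∈ l, (f a).Nodup) (h2 : ∀ a ∈ l, ∀ b ∈ l, ∀ x ∈ f a, x ∈ f b → a = b) :
    (l.flatMap f).Nodup := by
  refine List.nodup_flatMap.2 ⟨h1, ?_⟩
  refine hl.imp_of_mem fun {a b} ha hb hab => ?_
  exact fun x hxa hxb => hab (h2 a ha b hb x hxa hxb)

/-- The last entry of a list reveals both child references; the left one reveals the size `i`, and
then lengths determine the intermediate lists. In turn, the index of a new child is read off from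
the last entry of its visit. -/
theorem nodup_visits (j : ℕ) (L : List CNode) (m : ℕ) : (visits j L m).Nodup := by
  induction j using Nat.strong_induction_on generalizing L m with
  | _ j ih =>
    have hc : ∀ L i, (childVisits j L i).Nodup := by
      intro L i
      unfold childVisits
      split_ifs
      · exact (nodup_poolRefs j L).map fun c c' h => congrArg Prod.snd h
      · refine nodup_flatMap_of (List.nodup_finRange _) (fun a _ => ?_) fun a _ b _ x hx hx' => ?_
        · exact (ih _ (by omega) L i).map fun c c' h => congrArg Prod.fst h
        · obtain ⟨L', h, rfl⟩ := List.mem_map.1 hx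
          obtain ⟨L'', h', e⟩ := List.mem_map.1 hx'
          obtain rfl : L'' = L' := congrArg Prod.fst e
          obtain ⟨N, c, c', e1, -⟩ := visits_shape h
          obtain ⟨N', d, d', e2, -⟩ := visits_shape h'
          rw [e1] at e2
          have := (List.append_inj' e2 rfl).2
          simp only [List.cons.injEq, Prod.mk.injEq] at this
          exact Fin.ext (by omega)
    rw [visits_eq]
    have key : ∀ {L'} {x y : List CNode × ℕ}, L' ∈ (if y.2 ≠ x.2 ∧ (j, x.2, y.2) ∉ y.1 then
        [y.1 ++ [(j, x.2, y.2)]] else [] : List (List CNode)) → L' = y.1 ++ [(j, x.2, y.2)] := by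
      intro L' x y h
      split_ifs at h
      · simpa using h
      · simp at h
    refine nodup_flatMap_of List.nodup_range (fun i _ => ?_) ?_
    · refine nodup_flatMap_of (hc _ _) (fun x _ => ?_) ?_
      · refine nodup_flatMap_of (hc _ _) (fun y _ => ?_) ?_
        · split_ifs <;> simp
        · intro y _ y' _ L' h h'
          rw [key h] at h'
          have := List.append_inj' (key h') rfl
          simp only [List.cons.injEq, Prod.mk.injEq] at this
          exact Prod.ext this.1 (by tauto)
      · intro x hx x' hx' L' h h'
        obtain ⟨y, hy, h⟩ := List.mem_flatMap.1 h
        obtain ⟨y', hy', h'⟩ := List.mem_flatMap.1 h'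
        rw [key h] at h'
        have := List.append_inj' (key h') rfl
        simp only [List.cons.injEq, Prod.mk.injEq] at this
        obtain ⟨M, e1, l1, -⟩ := childVisits_shape hx
        obtain ⟨M', e1', l1', -⟩ := childVisits_shape hx'
        obtain ⟨N, e2, -⟩ := childVisits_shape hy
        obtain ⟨N', e2', -⟩ := childVisits_shape hy'
        refine Prod.ext ?_ (by tauto)
        have h3 := this.1
        rw [e2, e2'] at h3
        exact (List.append_inj h3 (by rw [e1, e1']; simp [l1, l1'])).1
    · intro i hi i' hi' L' h h'
      simp only [List.mem_flatMap] at h h'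
      obtain ⟨x, hx, y, hy, h⟩ := h
      obtain ⟨x', hx', y', hy', h'⟩ := h'
      rw [key h] at h'
      have := List.append_inj' (key h') rfl
      simp only [List.cons.injEq, Prod.mk.injEq] at this
      -- A new child has reference `L.length + i + 1`; for a pointer into the pool the truncated
      -- subtraction gives 0.
      have hi : ∀ {i x}, x ∈ childVisits j L i → i = x.2 - (L.length + 1) := by
        intro i x hx
        rcases mem_childVisits.1 hx with ⟨rfl, h1, h2⟩ | ⟨hi, a, h1, h2, h3, h4⟩
        · have := (mem_poolRefs.1 h2).1; omega
        · obtain ⟨N, e, l, -⟩ := childVisits_shape hx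
          rw [h4, e, List.length_append]; omega
      rw [hi hx, hi hx', this.2.1.2.1]

/-! ## Depth-first search -/

namespace BDD

/-- Depth-first search from the node `q`: append the new decision nodes to the list `S`. -/
def dfs {V : Type} [DecidableEq V] {k : ℕ} (A : BDD V k) (q : Bool ⊕ V) (S : List V) : List V :=
  match q with
  | Sum.inl _ => S
  | Sum.inr v => if v ∈ S then S else A.dfs (A.δ v true) (A.dfs (A.δ v false) S) ++ [v]
termination_by A.index q
decreasing_by
  · exact A.index_lt v false
  · exact A.index_lt v true

/-- The reference to the node `q`, when the decision nodes are listed in `S`. -/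
def ref {V : Type} [DecidableEq V] (S : List V) : Bool ⊕ V → ℕ
  | Sum.inl b => b.toNat
  | Sum.inr v => S.idxOf v + 2

/-- The code of the set `S` of decision nodes. -/
def code {V : Type} [DecidableEq V] {k : ℕ} (A : BDD V k) (S : List V) : List CNode :=
  S.map fun v => (A.index (Sum.inr v), ref S (A.δ v false), ref S (A.δ v true))

/-- The node `q` is a sink or in the list `S`. -/
def Known {V : Type} (S : List V) (q : Bool ⊕ V) : Prop := ∀ v, q = Sum.inr v → v ∈ S

/-- The list `S` contains the children of its elements, and no repetitions. -/
def Closed {V : Type} {k : ℕ} (A : BDD V k) (S : List V) : Prop :=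
  S.Nodup ∧ ∀ v ∈ S, ∀ b, Known S (A.δ v b)

theorem Known.append {V : Type} {S : List V} {q : Bool ⊕ V} (h : Known S q) (T : List V) :
    Known (S ++ T) q := fun v hv => List.mem_append_left _ (h v hv)

theorem index_pos {V : Type} {k : ℕ} (A : BDD V k) (v : V) : 0 < A.index (Sum.inr v) :=
  (Nat.zero_le _).trans_lt (A.index_lt v false)

theorem closed_nil {V : Type} {k : ℕ} (A : BDD V k) : A.Closed [] := ⟨List.nodup_nil, by simp⟩

section

variable {V : Type} [DecidableEq V] {k : ℕ}

theorem ref_append {S : List V} {q : Bool ⊕ V} (h : Known S q) (T : List V) :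
    ref (S ++ T) q = ref S q := by
  rcases q with b | v
  · rfl
  · simp only [ref]
    rw [List.idxOf_append_of_mem (h v rfl)]

theorem ref_lt {S : List V} {q : Bool ⊕ V} (h : Known S q) : ref S q < S.length + 2 := by
  rcases q with b | v
  · cases b <;> simp [ref]
  · have := List.idxOf_lt_length_iff.2 (h v rfl)
    simp only [ref]; omega

theorem ref_injective {S : List V} {q q' : Bool ⊕ V} (h : Known S q)
    (e : ref S q = ref S q') : q = q' := by
  rcases q with b | v <;> rcases q' with b' | v'
  · revert e; cases b <;> cases b' <;> simp [ref]
  · exfalso; revert e; cases b <;> simp [ref]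
  · exfalso; revert e; cases b' <;> simp [ref]
  · simp only [ref, add_left_inj] at e
    rw [(List.idxOf_inj (h v rfl)).1 e]

theorem code_append (A : BDD V k) {S : List V} (h : A.Closed S) (T : List V) :
    A.code (S ++ T) = A.code S ++ T.map fun v =>
      (A.index (Sum.inr v), ref (S ++ T) (A.δ v false), ref (S ++ T) (A.δ v true)) := by
  rw [code, List.map_append]
  congr 1
  refine List.map_congr_left fun v hv => ?_
  rw [ref_append (h.2 v hv false), ref_append (h.2 v hv true)]

@[simp] theorem length_code (A : BDD V k) (S : List V) : (A.code S).length = S.length := by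
  simp [code]

theorem refIndex_code (A : BDD V k) {S : List V} {q : Bool ⊕ V} (h : Known S q) :
    refIndex (A.code S) (ref S q) = A.index q := by
  rcases q with b | v
  · rw [A.index_sink]
    cases b <;> simp [ref, refIndex]
  · have := List.idxOf_lt_length_iff.2 (h v rfl)
    have e : ref S (Sum.inr v) = S.idxOf v + 2 := rfl
    rw [refIndex, e, if_neg (by omega), Nat.add_sub_cancel, List.getD_eq_getElem _ _ (by simpa using this)]
    simp [code]

/-- The list `S'` is the result of the depth-first search from `q`, starting with `S`. -/
structure DfsSpec (A : BDD V k) (q : Bool ⊕ V) (S S' : List V) : Prop where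
  closed : A.Closed S'
  known : Known S' q
  exists_append : ∃ T, S' = S ++ T ∧ (∀ v ∈ T, A.index (Sum.inr v) ≤ A.index q) ∧
    ∀ j, A.index q < j → (A.code S', ref S' q) ∈ childVisits j (A.code S) T.length
  visits : ∀ v, q = Sum.inr v → v ∉ S →
    A.code S' ∈ _root_.visits (A.index q) (A.code S) (S'.length - S.length)

theorem dfsSpec_of_known (A : BDD V k) {q : Bool ⊕ V} {S : List V} (hS : A.Closed S)
    (h : Known S q) : A.DfsSpec q S S where
  closed := hS
  known := h
  exists_append := ⟨[], by simp, by simp, fun j hj => mem_childVisits.2 <| Or.inl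
    ⟨rfl, rfl, mem_poolRefs.2 ⟨by simpa using ref_lt h, by rwa [A.refIndex_code h]⟩⟩⟩
  visits := fun v hv hn => absurd (h v hv) hn

/-- The search and `visits` follow the same recursion, and references stay valid because lists only
grow at the end. `low_ne_high` and `no_duplicate` of the diagram yield the two tests made by
`visits`. -/
theorem dfs_spec (A : BDD V k) (q : Bool ⊕ V) {S : List V} (hS : A.Closed S) :
    A.DfsSpec q S (A.dfs q S) := by
  obtain ⟨j, hj⟩ : ∃ j, A.index q = j := ⟨_, rfl⟩
  induction j using Nat.strong_induction_on generalizing q S with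
  | _ j ih =>
    rcases q with b | v
    · rw [dfs]
      exact A.dfsSpec_of_known hS (by rintro v ⟨⟩)
    rw [dfs]
    split_ifs with hv
    · exact A.dfsSpec_of_known hS (by rintro w ⟨⟩; exact hv)
    have hlt := A.index_lt v
    rw [hj] at hlt
    have h0 := ih _ (hlt false) (A.δ v false) hS rfl
    set S₁ := A.dfs (A.δ v false) S
    have h1 := ih _ (hlt true) (A.δ v true) h0.closed rfl
    set S₂ := A.dfs (A.δ v true) S₁
    obtain ⟨T₁, e1, i1, c1⟩ := h0.exists_append
    obtain ⟨T₂, e2, i2, c2⟩ := h1.exists_append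
    -- Everything found below the children has index smaller than that of `v`.
    have hv2 : v ∉ S₂ := by
      rw [e2, e1, List.mem_append, List.mem_append]
      rintro ((h | h) | h)
      · exact hv h
      · exact absurd (i1 v h) (by have := hlt false; omega)
      · exact absurd (i2 v h) (by have := hlt true; omega)
    have hk0 : Known S₂ (A.δ v false) := by rw [e2]; exact h0.known.append _
    have hk1 : Known S₂ (A.δ v true) := h1.known
    have hclosed : A.Closed (S₂ ++ [v]) := by
      refine ⟨by simpa using (List.nodup_concat _ _).2 ⟨hv2, h1.closed.1⟩, fun w hw b => ?_⟩
      rcases List.mem_append.1 hw with hw | hw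
      · exact (h1.closed.2 w hw b).append _
      · rw [List.mem_singleton] at hw
        subst hw
        cases b
        · exact hk0.append _
        · exact hk1.append _
    have hcode : A.code (S₂ ++ [v]) = A.code S₂ ++
        [(j, ref S₂ (A.δ v false), ref S₂ (A.δ v true))] := by
      rw [A.code_append h1.closed, List.map_singleton, ref_append hk0, ref_append hk1, hj]
    have hlen : (S₂ ++ [v]).length - S.length = T₁.length + T₂.length + 1 := by
      rw [e2, e1]; simp; omega
    have hvisit : A.code (S₂ ++ [v]) ∈ _root_.visits j (A.code S) (T₁.length + T₂.length + 1) := by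
      refine mem_visits.2 ⟨T₁.length, by omega, _, c1 j (hlt false), (A.code S₂, ref S₂ (A.δ v true)),
        ?_, ?_, ?_, ?_⟩
      · convert c2 j (hlt true) using 2
        omega
      · rw [← ref_append h0.known T₂, ← e2]
        intro h
        exact A.low_ne_high v (ref_injective hk1 h).symm
      · rw [← ref_append h0.known T₂, ← e2]
        intro h
        obtain ⟨u, hu, he⟩ := List.mem_map.1 h
        simp only [Prod.mk.injEq] at he
        rcases A.no_duplicate u v (fun h => hv2 (h ▸ hu)) (by rw [he.1, hj]) with h | h
        · exact h (ref_injective (h1.closed.2 u hu false) he.2.1)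
        · exact h (ref_injective (h1.closed.2 u hu true) he.2.2)
      · rw [← ref_append h0.known T₂, ← e2]
        exact hcode
    refine ⟨hclosed, by rintro w ⟨⟩; simp, ⟨T₁ ++ T₂ ++ [v], by rw [e2, e1]; simp, ?_, ?_⟩, ?_⟩
    · intro w hw
      rw [hj]
      simp only [List.mem_append, List.mem_singleton] at hw
      rcases hw with (h | h) | rfl
      · exact (i1 w h).trans (hlt false).le
      · exact (i2 w h).trans (hlt true).le
      · exact hj.le
    · intro i hi
      rw [hj] at hi
      refine mem_childVisits.2 (Or.inr ⟨by simp, j, ?_, hi, ?_, ?_⟩)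
      · have := A.index_pos v; omega
      · simpa [add_assoc] using hvisit
      · have : S₂.idxOf v = S₂.length := List.idxOf_eq_length hv2
        simp [ref, List.idxOf_append, hv2]
    · intro w _ _
      rw [hlen, hj]
      exact hvisit

/-- The decision nodes in the order of a depth-first search from the root. -/
def order (A : BDD V k) : List V := A.dfs A.root []

/-- A node other than the root has a parent, of larger index. Induction on `k - index` reaches the
parent first, and closedness of the result passes to the child. -/
theorem mem_order (A : BDD V k) (v : V) : v ∈ A.order := by
  have h := A.dfs_spec A.root A.closed_nil
  obtain ⟨d, hd⟩ : ∃ d, k - A.index (Sum.inr v) = d := ⟨_, rfl⟩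
  induction d using Nat.strong_induction_on generalizing v with
  | _ d ih =>
    by_cases hr : Sum.inr v = A.root
    · exact h.known v hr.symm
    · have := mt (A.source_iff (Sum.inr v)).1 hr
      push Not at this
      obtain ⟨u, b, hu⟩ := this
      have h1 := A.index_lt u b
      rw [hu] at h1
      have h2 := A.index_le (Sum.inr u)
      exact h.closed.2 u (ih _ (by omega) u rfl) b v hu

theorem nodup_order (A : BDD V k) : A.order.Nodup := (A.dfs_spec A.root A.closed_nil).closed.1

theorem length_order [Fintype V] (A : BDD V k) : A.order.length = Fintype.card V := by
  rw [← List.toFinset_card_of_nodup A.nodup_order, ← Finset.card_univ]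
  congr 1
  ext v
  simp [A.mem_order v]

theorem known_order (A : BDD V k) (q : Bool ⊕ V) : Known A.order q := fun v _ => A.mem_order v

/-- The code of a diagram. -/
def canon (A : BDD V k) : List CNode := A.code A.order

theorem canon_mem_visits [Fintype V] (A : BDD V k) (hk : 1 ≤ k) :
    A.canon ∈ _root_.visits k [] (Fintype.card V) := by
  have h := A.dfs_spec A.root A.closed_nil
  rcases hr : A.root with b | v
  · have := A.index_root
    rw [hr, A.index_sink] at this
    omega
  · have := h.visits v hr (by simp)
    rw [A.index_root] at this
    rw [← A.length_order]
    exact this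

end

section

variable {V W : Type} [DecidableEq V] [DecidableEq W] {k : ℕ}

theorem dfs_map {A : BDD V k} {B : BDD W k} {e : V ≃ W}
    (h : ∀ v b, B.δ (e v) b = Sum.map id e (A.δ v b)) (q : Bool ⊕ V) (S : List V) :
    B.dfs (Sum.map id e q) (S.map e) = (A.dfs q S).map e := by
  obtain ⟨j, hj⟩ : ∃ j, A.index q = j := ⟨_, rfl⟩
  induction j using Nat.strong_induction_on generalizing q S with
  | _ j ih =>
    rcases q with b | v
    · rw [dfs, Sum.map_inl, dfs]
    · rw [dfs, Sum.map_inr, dfs]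
      have hlt := A.index_lt v
      rw [hj] at hlt
      rw [h, h, ih _ (hlt false) _ _ rfl, ih _ (hlt true) _ _ rfl]
      simp only [List.mem_map, EmbeddingLike.apply_eq_iff_eq, exists_eq_right]
      split_ifs <;> simp

theorem ref_map (e : V ≃ W) (S : List V) (q : Bool ⊕ V) :
    ref (S.map e) (Sum.map id e q) = ref S q := by
  rcases q with b | v
  · rfl
  · simp only [ref, Sum.map_inr, add_left_inj]
    induction S with
    | nil => rfl
    | cons u S ih =>
      have : (e u == e v) = (u == v) := by rw [Bool.eq_iff_iff]; simp
      simp [List.idxOf_cons, ih, this]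

theorem Iso.canon_eq {A : BDD V k} {B : BDD W k} (h : A.Iso B) : B.canon = A.canon := by
  obtain ⟨e, h1, h2, h3⟩ := h
  have ho : B.order = A.order.map e := by
    rw [order, h2]
    exact dfs_map h3 A.root []
  rw [canon, ho, code, List.map_map]
  refine List.map_congr_left fun v _ => ?_
  simp only [Function.comp_apply, h3, ref_map]
  rw [← h1, Sum.map_inr]

/-- Matching the nodes in equal positions of the two search orders gives the bijection; injectivity
of references turns equal codes into equal transitions. -/
theorem iso_of_canon_eq {A : BDD V k} {B : BDD W k} (h : A.canon = B.canon) : A.Iso B := by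
  have hlen : A.order.length = B.order.length := by
    simpa [canon] using congrArg List.length h
  let eA := A.nodup_order.getEquivOfForallMemList A.order A.mem_order
  let eB := B.nodup_order.getEquivOfForallMemList B.order B.mem_order
  let e : V ≃ W := eA.symm.trans ((finCongr hlen).trans eB)
  have he : A.order.map e = B.order := by
    refine List.ext_getElem (by simpa using hlen) fun i h1 h2 => ?_
    have h1' : i < A.order.length := by simpa using h1
    have : eA.symm A.order[i] = ⟨i, h1'⟩ := by
      rw [Equiv.symm_apply_eq]; rfl
    simp only [List.getElem_map, e, Equiv.trans_apply, this]
    rfl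
  have hcode : ∀ v, (A.index (Sum.inr v), ref A.order (A.δ v false), ref A.order (A.δ v true)) =
      (B.index (Sum.inr (e v)), ref B.order (B.δ (e v) false), ref B.order (B.δ (e v) true)) := by
    have : B.canon = A.order.map fun v => (B.index (Sum.inr (e v)),
        ref B.order (B.δ (e v) false), ref B.order (B.δ (e v) true)) := by
      rw [canon, code]
      conv_lhs => rw [← he, List.map_map]
      rw [he]; rfl
    rw [this, canon, code] at h
    exact fun v => List.map_inj_left.1 h v (A.mem_order v)
  have hδ : ∀ v b, B.δ (e v) b = Sum.map id e (A.δ v b) := by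
    intro v b
    have h1 := hcode v
    simp only [Prod.mk.injEq] at h1
    have h2 : ref A.order (A.δ v b) = ref B.order (B.δ (e v) b) := by
      cases b
      · exact h1.2.1
      · exact h1.2.2
    rw [← ref_map e, he] at h2
    exact (ref_injective (B.known_order _) h2.symm)
  refine ⟨e, ?_, ?_, hδ⟩
  · rintro (b | v)
    · rw [Sum.map_inl, B.index_sink, A.index_sink]
    · exact (congrArg Prod.fst (hcode v)).symm
  -- The code does not name the root, but the image of the root of `A` has in-degree 0 in `B`, and
  -- such a node is unique.
  · refine ((B.source_iff _).1 fun w b hw => ?_).symm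
    obtain ⟨v, rfl⟩ := e.surjective w
    rw [hδ] at hw
    have hinj : Function.Injective (Sum.map (id : Bool → Bool) e) :=
      Function.injective_id.sumMap e.injective
    exact (A.source_iff A.root).2 rfl v b (hinj hw)

end

end BDD

/-! ## Decoding -/

/-- The node with reference `c`, for lists of length `m`. -/
def toNode (m c : ℕ) : Bool ⊕ Fin m :=
  -- References from `m + 2` on also go to a sink; this is harmless, since a pool contains no such
  -- references.
  if h : 2 ≤ c ∧ c < m + 2 then Sum.inr ⟨c - 2, by omega⟩ else Sum.inl (decide (c = 1))

/-- The reference to a node. -/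
def ofNode {m : ℕ} : Bool ⊕ Fin m → ℕ
  | Sum.inl b => b.toNat
  | Sum.inr i => i.val + 2

theorem ofNode_toNode {m c : ℕ} (hc : c < m + 2) : ofNode (toNode m c) = c := by
  unfold toNode
  split_ifs with h
  · simp only [ofNode]; omega
  · have : c = 0 ∨ c = 1 := by omega
    rcases this with rfl | rfl <;> simp [ofNode]

theorem toNode_ofNode {m : ℕ} (q : Bool ⊕ Fin m) : toNode m (ofNode q) = q := by
  rcases q with b | i
  · cases b <;> simp [toNode, ofNode]
  · simp [toNode, ofNode]

theorem toNode_inj {m c c' : ℕ} (hc : c < m + 2) (hc' : c' < m + 2)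
    (h : toNode m c = toNode m c') : c = c' := by
  rw [← ofNode_toNode hc, h, ofNode_toNode hc']

theorem visits_index_le {j m : ℕ} {L' : List CNode} (h : L' ∈ visits j [] m) {v : CNode}
    (hv : v ∈ L') : v.1 ≤ j := by
  obtain ⟨N, c, c', e, -, hN⟩ := visits_shape h
  rw [e, List.nil_append, List.mem_append, List.mem_singleton] at hv
  rcases hv with hv | rfl
  · exact (hN v hv).le
  · exact le_refl _

/-- A new node is created only as a child of the node being processed, which then refers to it. The
bound `L'.length + 1` leaves out the last node, the root of the visit. -/
theorem visits_covered {j m : ℕ} {L L' : List CNode} (h : L' ∈ visits j L m) {c : ℕ}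
    (h1 : L.length + 2 ≤ c) (h2 : c < L'.length + 1) : ∃ v ∈ L', v.2.1 = c ∨ v.2.2 = c := by
  induction j using Nat.strong_induction_on generalizing m L L' with
  | _ j ih =>
    have hc : ∀ {L i} {x : List CNode × ℕ}, x ∈ childVisits j L i → L.length + 2 ≤ c →
        c < x.1.length + 2 → x.2 = c ∨ ∃ v ∈ x.1, v.2.1 = c ∨ v.2.2 = c := by
      intro L i x hx h1 h2
      rcases mem_childVisits.1 hx with ⟨-, h3, -⟩ | ⟨-, a, -, h4, h5, h6⟩
      · rw [h3] at h2; omega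
      · by_cases h7 : c < x.1.length + 1
        · exact Or.inr (ih a h4 h5 h1 h7)
        · left; omega
    obtain ⟨i, hi, x, hx, y, hy, -, -, rfl⟩ := mem_visits.1 h
    obtain ⟨N, e, -⟩ := childVisits_shape hy
    rw [List.length_append, List.length_singleton] at h2
    by_cases h3 : c < x.1.length + 2
    · rcases hc hx h1 h3 with h4 | ⟨v, hv, h4⟩
      · exact ⟨_, List.mem_append_right _ (List.mem_singleton_self _), Or.inl h4⟩
      · exact ⟨v, List.mem_append_left _ (e ▸ List.mem_append_left _ hv), h4⟩
    · rcases hc hy (by omega) (by omega) with h4 | ⟨v, hv, h4⟩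
      · exact ⟨_, List.mem_append_right _ (List.mem_singleton_self _), Or.inr h4⟩
      · exact ⟨v, List.mem_append_left _ hv, h4⟩

theorem IsPool.sinks_covered {L : List CNode} (h : IsPool L) (hL : L ≠ []) {c : ℕ} (hc : c < 2) :
    ∃ v ∈ L, v.2.1 = c ∨ v.2.2 = c := by
  induction h with
  | nil => exact absurd rfl hL
  | @concat L j d d' hL' hd hd' hne hnew ih =>
    by_cases h0 : L = []
    · subst h0
      have h1 := (mem_poolRefs.1 hd).1
      have h2 := (mem_poolRefs.1 hd').1
      simp only [List.length_nil] at h1 h2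
      -- The first node of a pool can only refer to the sinks, and its two references differ, so it
      -- has both as children.
      exact ⟨(j, d, d'), by simp, by dsimp only; omega⟩
    · obtain ⟨v, hv, h⟩ := ih h0
      exact ⟨v, List.mem_append_left _ hv, h⟩

theorem refIndex_add_two {L : List CNode} {i : ℕ} (hi : i < L.length) :
    refIndex L (i + 2) = L[i].1 := by
  rw [refIndex, if_neg (by omega), Nat.add_sub_cancel, List.getD_eq_getElem _ _ hi]

/-- A reference to a child of a node. -/
def CNode.child (v : CNode) (b : Bool) : ℕ := if b then v.2.2 else v.2.1

theorem IsPool.child_mem {L : List CNode} (h : IsPool L) {v : CNode} (hv : v ∈ L) (b : Bool) :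
    v.child b ∈ poolRefs v.1 L := by
  cases b
  · exact (h.refs hv).1
  · exact (h.refs hv).2.1

/-- The diagram with a given code. -/
def decode {k m : ℕ} (L : List CNode) (hm : L.length = m)
    (hL : L ∈ visits k [] m) : BDD (Fin m) k where
  index q := refIndex L (ofNode q)
  index_le := by
    rintro (b | i)
    · cases b <;> simp [ofNode, refIndex]
    · have hi : i.val < L.length := by omega
      have hmem := List.getElem_mem hi
      simp only [ofNode]
      rw [refIndex_add_two hi]
      exact visits_index_le hL hmem
  index_sink b := by cases b <;> simp [ofNode, refIndex]
  root := toNode m (m + 1)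
  index_root := by
    obtain ⟨N, c, c', e, hl, -⟩ := visits_shape hL
    rw [List.nil_append] at e
    rw [ofNode_toNode (by omega), e, ← hl, refIndex_concat]
  δ i b := toNode m ((L[i.val]'(hm ▸ i.2)).child b)
  low_ne_high i h := by
    have hP := IsPool.nil.visits hL
    have hi : i.val < L.length := by omega
    have hmem := List.getElem_mem hi
    have h0 := (mem_poolRefs.1 (hP.child_mem hmem false)).1
    have h1 := (mem_poolRefs.1 (hP.child_mem hmem true)).1
    exact (hP.refs hmem).2.2 (toNode_inj (hm ▸ h0) (hm ▸ h1) h).symm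
  no_duplicate i i' hne hidx := by
    have hP := IsPool.nil.visits hL
    have hi : i.val < L.length := by omega
    have hi' : i'.val < L.length := by omega
    by_contra hcon
    push Not at hcon
    have hb : ∀ b, L[i.val].child b = L[i'.val].child b := by
      intro b
      have h0 := (mem_poolRefs.1 (hP.child_mem (List.getElem_mem hi) b)).1
      have h1 := (mem_poolRefs.1 (hP.child_mem (List.getElem_mem hi') b)).1
      refine toNode_inj (hm ▸ h0) (hm ▸ h1) ?_
      cases b
      · exact hcon.1
      · exact hcon.2
    simp only [ofNode] at hidx
    rw [refIndex_add_two hi, refIndex_add_two hi'] at hidx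
    have : L[i.val] = L[i'.val] := Prod.ext hidx (Prod.ext (hb false) (hb true))
    exact hne (Fin.ext ((hP.nodup.getElem_inj_iff).1 this))
  index_lt i b := by
    have hP := IsPool.nil.visits hL
    have hi : i.val < L.length := by omega
    have h0 := mem_poolRefs.1 (hP.child_mem (List.getElem_mem hi) b)
    rw [ofNode_toNode (hm ▸ h0.1)]
    simp only [ofNode]
    rw [refIndex_add_two hi]
    exact h0.2
  source_iff q := by
    have hP := IsPool.nil.visits hL
    obtain ⟨N, c, c', e, hl, hN⟩ := visits_shape hL
    rw [List.nil_append] at e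
    constructor
    · intro h
      by_contra hq
      have hlt : ofNode q < m + 1 := by
        rcases q with b | i
        · cases b <;> simp [ofNode]; omega
        · have : i.val ≠ m - 1 := by
            rintro h
            apply hq
            rw [← toNode_ofNode (Sum.inr i)]
            simp only [ofNode]
            congr 1; omega
          simp only [ofNode]; omega
      have : ∃ v ∈ L, v.2.1 = ofNode q ∨ v.2.2 = ofNode q := by
        by_cases h2 : ofNode q < 2
        · exact hP.sinks_covered (by rw [e]; simp) h2
        · exact visits_covered hL (by simp; omega) (by omega)
      obtain ⟨v, hv, h1⟩ := this
      obtain ⟨i, hi, rfl⟩ := List.getElem_of_mem hv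
      rcases h1 with h1 | h1
      · exact h ⟨i, hm ▸ hi⟩ false (by rw [← toNode_ofNode q, ← h1]; rfl)
      · exact h ⟨i, hm ▸ hi⟩ true (by rw [← toNode_ofNode q, ← h1]; rfl)
    · rintro rfl i b h
      have hi : i.val < L.length := by omega
      have h0 := mem_poolRefs.1 (hP.child_mem (List.getElem_mem hi) b)
      have h1 := toNode_inj (hm ▸ h0.1) (by omega) h
      have h2 : refIndex L (m + 1) = k := by rw [e, ← hl, refIndex_concat]
      rw [h1, h2] at h0
      -- A parent of the last node would have index greater than `k`.
      exact absurd (visits_index_le hL (List.getElem_mem hi)) (not_le.2 h0.2)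

/-! ### Searching a decoded diagram -/

/-- The first `n` elements of `Fin m`. -/
def firstFin (m n : ℕ) : List (Fin m) := (List.finRange m).take n

theorem mem_firstFin {m n : ℕ} {i : Fin m} : i ∈ firstFin m n ↔ i.val < n := by
  rw [firstFin, List.mem_take_iff_getElem]
  simp only [List.length_finRange, List.getElem_finRange]
  constructor
  · rintro ⟨a, h1, h2⟩
    rw [← h2]; simp; omega
  · intro h
    exact ⟨i, by omega, rfl⟩

theorem firstFin_succ {m n : ℕ} (h : n < m) :
    firstFin m (n + 1) = firstFin m n ++ [⟨n, h⟩] := by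
  rw [firstFin, List.take_add_one]
  simp [firstFin, h]

/-- The search replays the visit that produced the code, so the nodes found at any moment form an
initial segment of `Fin m`. The suffix `R` allows for partial visits, while the diagram is decoded
from the whole list. -/
theorem dfs_decode_visits {k m : ℕ} {L : List CNode} (hm : L.length = m)
    (hL : L ∈ visits k [] m) {j i : ℕ} {L₀ L₁ R : List CNode} (h : L₁ ∈ visits j L₀ i)
    (hR : L = L₁ ++ R) :
    (decode L hm hL).dfs (toNode m (L₁.length + 1)) (firstFin m L₀.length) =
      firstFin m L₁.length := by
  induction j using Nat.strong_induction_on generalizing i L₀ L₁ R with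
  | _ j ih =>
    have hc : ∀ {L₀ i R} {x : List CNode × ℕ}, x ∈ childVisits j L₀ i → L = x.1 ++ R →
        (decode L hm hL).dfs (toNode m x.2) (firstFin m L₀.length) =
          firstFin m x.1.length := by
      intro L₀ i R x hx hR
      rcases mem_childVisits.1 hx with ⟨-, h1, h2⟩ | ⟨-, a, -, h2, h3, h4⟩
      · have hlt := (mem_poolRefs.1 h2).1
        rw [h1]
        by_cases h3 : 2 ≤ x.2
        · have hlen : L₀.length ≤ m := by rw [← hm, hR, h1]; simp
          rw [toNode, dif_pos ⟨h3, by omega⟩, BDD.dfs, if_pos]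
          rw [mem_firstFin]
          simp only; omega
        · rw [toNode, dif_neg (by omega), BDD.dfs]
      · rw [h4]
        exact ih a h2 h3 hR
    obtain ⟨i', hi, x, hx, y, hy, -, -, rfl⟩ := mem_visits.1 h
    obtain ⟨M, e1, -⟩ := childVisits_shape hx
    obtain ⟨N, e2, -⟩ := childVisits_shape hy
    have hlen : y.1.length < m := by rw [← hm, hR]; simp
    have hlt : y.1.length < L.length := by omega
    have hget : L[y.1.length] = (j, x.2, y.2) := by
      simp [hR]
    have hx' := hc hx (R := N ++ [(j, x.2, y.2)] ++ R) (by rw [hR, e2]; simp)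
    have hy' := hc hy (R := [(j, x.2, y.2)] ++ R) (by rw [hR]; simp)
    have hδ : ∀ b, (decode L hm hL).δ ⟨y.1.length, hlen⟩ b =
        toNode m (CNode.child (j, x.2, y.2) b) := by
      intro b
      simp only [decode, hget]
    rw [List.length_append, List.length_singleton, firstFin_succ hlen, toNode,
      dif_pos ⟨by omega, by omega⟩]
    simp only [show y.1.length + 1 + 1 - 2 = y.1.length by omega]
    rw [BDD.dfs, if_neg, hδ, hδ]
    · simp only [CNode.child, if_true]
      have : ∀ a b : ℕ, (if false = true then a else b) = b := by simp
      rw [this, hx', hy']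
    · rw [mem_firstFin]
      simp only [e2, e1, List.length_append]; omega

theorem canon_decode {k m : ℕ} {L : List CNode} (hm : L.length = m)
    (hL : L ∈ visits k [] m) : (decode L hm hL).canon = L := by
  have ho : (decode L hm hL).order = List.finRange m := by
    have := dfs_decode_visits hm hL hL (R := []) (by simp)
    rw [hm] at this
    have e : firstFin m m = List.finRange m := List.take_of_length_le (by simp)
    rwa [e] at this
  have href : ∀ q : Bool ⊕ Fin m, BDD.ref (List.finRange m) q = ofNode q := by
    rintro (b | i)
    · rfl
    · simp [BDD.ref, ofNode]
  rw [BDD.canon, ho]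
  refine List.ext_getElem (by simp [hm]) fun i h1 h2 => ?_
  have hmem := List.getElem_mem h2
  have hP := IsPool.nil.visits hL
  have h3 := (mem_poolRefs.1 (hP.refs hmem).1).1
  have h4 := (mem_poolRefs.1 (hP.refs hmem).2.1).1
  rw [hm] at h3 h4
  simp only [BDD.code, List.getElem_map, href, List.getElem_finRange]
  refine Prod.ext (refIndex_add_two h2) (Prod.ext ?_ ?_)
  · exact ofNode_toNode h3
  · exact ofNode_toNode h4

/-- `BDD.canon` descends to isomorphism classes, is injective there, and has `decode` as a section.
-/
theorem numBDD_eq_length_visits {k : ℕ} (hk : 1 ≤ k) (n : ℕ) :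
    numBDD n k = (visits k [] (n - 2)).length := by
  have hcard : ∀ A : BDD (Fin (n - 2)) k, A.canon ∈ visits k [] (n - 2) := fun A => by
    simpa using A.canon_mem_visits hk
  let f : Quotient (BDD.isoSetoid (Fin (n - 2)) k) → {L // L ∈ visits k [] (n - 2)} :=
    Quotient.lift (fun A => ⟨A.canon, hcard A⟩) fun A B h => Subtype.ext (BDD.Iso.canon_eq h).symm
  have hf : Function.Bijective f := by
    constructor
    · intro a b
      induction a using Quotient.inductionOn
      induction b using Quotient.inductionOn
      exact fun h => Quotient.sound (BDD.iso_of_canon_eq (congrArg Subtype.val h))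
    · rintro ⟨L, hL⟩
      have hm : L.length = n - 2 := by
        obtain ⟨N, c, c', e, hl, -⟩ := visits_shape hL
        rw [e]; simpa using hl
      exact ⟨Quotient.mk _ (decode L hm hL), Subtype.ext (canon_decode hm hL)⟩
  rw [numBDD, Nat.card_eq_of_bijective f hf, Nat.card_eq_fintype_card,
    Fintype.card_of_subtype (visits k [] (n - 2)).toFinset (by simp),
    List.toFinset_card_of_nodup (nodup_visits _ _ _)]

theorem mainTheorem6 :
    (∀ n k : ℕ, 1 ≤ k → countValue n k = (numBDD n k : ℤ)) ∧
    ∃ C : ℝ, ∀ n k : ℕ, 1 ≤ k → n ≤ 2 ^ k + 1 →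
      (countOps n k : ℝ) ≤ C * ((1 / (k : ℝ)) * (2 : ℝ) ^ (3 * (k : ℝ) ^ 2 / 2 + (k : ℝ))) := by
  refine ⟨fun n k hk => ?_, exists_countOps_le⟩
  rw [(evalRun_spec n k hk).1, wsum_countDict_eq_length_visits hk, numBDD_eq_length_visits hk]
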